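/- Let $D>3$ denote a prime with $D\equiv 3\pmod 4$, let $\chi_D(n)=\left(\frac{-D}{n}\right)$ (Kronecker symbol), a primitive quadratic Dirichlet character of conductor $D$, and let $L(s,\chi_D)$ be its Dirichlet $L$-function. For $c>0$ say that Hypothesis $\mathrm{H}(c)$ holds for $L(s,\chi_D)$ if every zero $\rho=\beta+i\gamma$ of $L(s,\chi_D)$ with $|\gamma|\le 1$ satisfies $\beta\le 1-c/\log D$. **Corollary.** For every $c>0$ and $K>0$ there is a constant $C=C(c,K)>0$ such that the following holds. Let $0<\theta<1$ and $0<\alpha_1<\alpha_2<1$ with $\theta\le K\alpha_1$. Then there is $x_0=x_0(c,K,\theta,\alpha_1,\alpha_2)$ such that for all real $x\ge x_0$ and all primes $D>3$, $D\equiv 3\pmod 4$, with $D=x^\theta$ for which $L(s,\chi_D)$ satisfies $\mathrm{H}(c)$: 1. $$\Bigl|\sum_{x^{\alpha_1}\le p<x^{\alpha_2}}\frac{\chi_D(p)}{p}\Bigr|\le C\exp\Bigl(\frac{-c\alpha_1}{3\theta}\Bigr);$$ 2. for every smooth $\varphi:\mathbb R\to\mathbb C$ supported in $[\alpha_1,\alpha_2]$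 and every $A$ with $(\alpha_2-\alpha_1)^{j}\,|\varphi^{(j)}(u)|\le A$ for all $u\in\mathbb R$ and $0\le j\le 3$, $$\Bigl|\sum_{p}\frac{\chi_D(p)}{p}\,\varphi\Bigl(\frac{\log p}{\log x}\Bigr)\Bigr|\le C\,A\,(\alpha_2-\alpha_1)^{-2}\exp\Bigl(\frac{-c\alpha_1}{\theta}\Bigr).$$ Here $p$ runs over primes. (The parameter $K$ restricts nothing: every $\theta,\alpha_1$ is covered by $K=1/\alpha_1$; it records that the implied constants depend only on $c$ and on an upper bound for $\theta/\alpha_1$.) -/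

import Mathlib

open scoped ContDiff

/-- The Kronecker symbol `(a / n)` for an integer `a` and a natural number `n`: the Jacobi symbol
for odd `n`, extended multiplicatively by `(a / 2) = 0, 1, -1` according as `a` is even,
`a ≡ ±1 mod 8`, `a ≡ ±3 mod 8`, and by `(a / 0) = 1` if `a = ±1` and `0` otherwise. -/
def kroneckerSym (a : ℤ) (n : ℕ) : ℤ :=
  if n = 0 then (if a.natAbs = 1 then 1 else 0)
  else ZMod.χ₈ (a : ZMod 8) ^ (n.factorization 2) * jacobiSym a (ordCompl[2] n)

/-- The quadratic Dirichlet character modulo a prime `D`. For `D > 3`, `D ≡ 3 mod 4` this is the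
character `χ_D(n) = (-D / n)` (Kronecker symbol), see `chiD_eq_kroneckerSym`. -/
noncomputable def chiD (D : ℕ) [Fact D.Prime] : DirichletCharacter ℂ D :=
  (quadraticChar (ZMod D)).ringHomComp (Int.castRingHom ℂ)

theorem chiD_eq_kroneckerSym (D : ℕ) [Fact D.Prime] (hD : D % 4 = 3) (n : ℕ) :
    chiD D (n : ZMod D) = (kroneckerSym (-(D : ℤ)) n : ℂ) := by
  have hodd : Odd D := by rw [Nat.odd_iff]; omega
  have key : ∀ m : ℕ, chiD D (m : ZMod D) = (jacobiSym m D : ℂ) := by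
    intro m
    rw [← jacobiSym.legendreSym.to_jacobiSym]
    simp [chiD, legendreSym, MulChar.ringHomComp_apply]
  rw [key, kroneckerSym]
  split_ifs with h0 h1
  · simp at h1; omega
  · subst h0
    have : 1 < D := (Fact.out : D.Prime).one_lt
    simp [jacobiSym.zero_left this]
  · norm_cast
    have hm : Odd (ordCompl[2] n) := by
      rw [← Nat.not_even_iff_odd, even_iff_two_dvd]
      exact Nat.not_dvd_ordCompl Nat.prime_two h0
    set m := ordCompl[2] n with hmdef
    have h2 : ZMod.χ₈ ((-(D : ℤ) : ℤ) : ZMod 8) = jacobiSym 2 D := by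
      rw [jacobiSym.at_two hodd]
      push_cast
      have h : ∀ z : ZMod 8, ZMod.χ₈ (-z) = ZMod.χ₈ z := by decide
      exact h _
    have h3 : jacobiSym (-(D : ℤ)) m = jacobiSym m D := by
      rw [jacobiSym.neg _ hm]
      rcases Nat.odd_mod_four_iff.mp (Nat.odd_iff.mp hm) with h | h
      · rw [ZMod.χ₄_nat_one_mod_four h, one_mul]
        exact jacobiSym.quadratic_reciprocity_one_mod_four' hodd h
      · rw [ZMod.χ₄_nat_three_mod_four h, jacobiSym.quadratic_reciprocity_three_mod_four hD h]
        ring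
    rw [h2, h3]
    have hn : (n : ℤ) = 2 ^ n.factorization 2 * (m : ℤ) := by
      exact_mod_cast (Nat.ordProj_mul_ordCompl_eq_self n 2).symm
    rw [← jacobiSym.pow_left, ← jacobiSym.mul_left, ← hn]

/-- Hypothesis `H(c)` for an `L`-function `L` of conductor `Δ`: every zero `ρ = β + iγ` of `L` with
`|γ| ≤ 1` satisfies `β ≤ 1 - c / log Δ`. -/
def HypothesisH (L : ℂ → ℂ) (Δ c : ℝ) : Prop :=
  ∀ ρ : ℂ, L ρ = 0 → |ρ.im| ≤ 1 → ρ.re ≤ 1 - c / Real.log Δ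

/-- The sum of `χ_D(p) / p` over the primes `y ≤ p < z`. -/
noncomputable def primeCharSum (D : ℕ) [Fact D.Prime] (y z : ℝ) : ℂ :=
  ∑ p ∈ (Finset.range ⌈z⌉₊).filter (fun p : ℕ => p.Prime ∧ y ≤ (p : ℝ)),
    chiD D (p : ZMod D) / (p : ℂ)

/-- The sum of `χ_D(p) / p * φ(log p / log x)` over all primes `p`. -/
noncomputable def smoothPrimeCharSum (D : ℕ) [Fact D.Prime] (φ : ℝ → ℂ) (x : ℝ) : ℂ :=
  ∑' p : Nat.Primes,
    chiD D ((p : ℕ) : ZMod D) / ((p : ℕ) : ℂ) * φ (Real.log ((p : ℕ) : ℝ) / Real.log x)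

/-- For `x > 1` and `φ` supported on a bounded interval the above sum has only finitely many
nonzero terms, so that the infinite sum is a genuine one. -/
theorem smoothPrimeCharSum_finite (D : ℕ) [Fact D.Prime] (φ : ℝ → ℂ) (x a b : ℝ) (hx : 1 < x)
    (hφ : Function.support φ ⊆ Set.Icc a b) :
    (Function.support fun p : Nat.Primes => chiD D ((p : ℕ) : ZMod D) / ((p : ℕ) : ℂ) *
      φ (Real.log ((p : ℕ) : ℝ) / Real.log x)).Finite := by
  have hfin : {p : Nat.Primes | (p : ℕ) ∈ Set.Iic ⌊Real.exp (b * Real.log x)⌋₊}.Finite :=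
    (Set.finite_Iic _).preimage (fun p _ q _ h => Subtype.ext h)
  refine hfin.subset fun p hp => ?_
  have h1 : φ (Real.log ((p : ℕ) : ℝ) / Real.log x) ≠ 0 := by
    intro h; exact hp (by simp [h])
  have h2 := (hφ h1).2
  rw [div_le_iff₀ (Real.log_pos hx)] at h2
  have hpos : (0 : ℝ) < ((p : ℕ) : ℝ) := by exact_mod_cast p.2.pos
  exact Nat.le_floor ((Real.log_le_iff_le_exp hpos).mp h2)

/-! Write $L=\log x$ and $l=\log D=\theta L$. Laplace inversion expresses
$\sum\chi(n)\Lambda(n)n^{-1}g(\log n)$ as an integral of the transform $\hat g$ against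
$-L'/L(1+z,\chi)$ on the line $\Re z=\eta>0$. The contour never crosses a zero. Near $s=1$ one has
$L'/L(s)=E(s)+\sum_\rho 1/(s-\rho)$ with finitely many zeros $\rho$ and $E\ll l$ holomorphic
(`exists_LFunction_partial_fractions`), and integrating $\hat g$ against $1/(s-\rho)$ returns
exactly $\hat g(\rho-1)$ (`laplaceTransform_eq_integral_cauchy`).

If $g$ lives on $[a,b]$ with $a=\alpha_1L$, two integrations by parts and $\Re\rho\le1-c/l$ give
$|\hat g(\rho-1)|\ll|\rho-1|^{-2}e^{-ca/l}M/a^2$, where $M$ controls two scaled derivatives.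
Moreover $\sum_\rho|\rho-1|^{-2}\ll l^2$: at $s=1+1/l$ every $\Re\,1/(s-\rho)$ is positive, their
sum is $O(l)$, and H(c) makes $|s-\rho|\ll|\rho-1|$. So the zeros contribute
$M(\theta/\alpha_1)^2e^{-c\alpha_1/\theta}$. All other terms are controlled by three derivatives but
carry a factor tending to $0$ as $x\to\infty$, so they are absorbed by the choice of $x_0$
(`exists_norm_smoothPrimeCharSum_le`).

The smooth estimate follows at once. For the sharp cutoff, $[\alpha_1,\alpha_2)$ is smoothed with
ramps of relative width $1/Y$: the zeros then cost $Y^2e^{-c\alpha_1/\theta}$ and the ramps, by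
Chebyshev, $O(1/Y)$ up to terms vanishing with $x$. Balancing gives $Y=e^{c\alpha_1/(3\theta)}$,
hence the exponent with $3$. -/

/-! ### Zeros and logarithmic derivatives of entire functions on a disc. -/

open Complex Metric in
/-- Removing one zero from an entire function by a Blaschke factor of the disc of radius `R`. -/
theorem exists_blaschke_quotient {f : ℂ → ℂ} (hf : Differentiable ℂ f) {R r B : ℝ} (hr : 0 < r)
    (hrR : r < R) (h0 : f 0 ≠ 0) (hB : ∀ z ∈ closedBall (0 : ℂ) R, ‖f z‖ ≤ B)
    {ρ : ℂ} (hρ : f ρ = 0) (hρr : ‖ρ‖ < r) :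
    ∃ k : ℂ → ℂ, Differentiable ℂ k ∧ (∀ z ∈ closedBall (0 : ℂ) R, ‖k z‖ ≤ B) ∧
      ‖f 0‖ * (R / r) ≤ ‖k 0‖ ∧ (∀ z ∈ ball (0 : ℂ) r, k z = 0 → f z = 0) ∧
      ∀ z ∈ ball (0 : ℂ) r, f z ≠ 0 → k z ≠ 0 ∧
        logDeriv f z = logDeriv k z + (1 / (z - ρ) + star ρ / (R ^ 2 - star ρ * z)) := by
  have hR : 0 < R := hr.trans hrR
  have hρ0 : ρ ≠ 0 := fun h => h0 (h ▸ hρ)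
  set d : ℂ → ℂ := dslope f ρ with hd
  have hdd : Differentiable ℂ d := by
    rw [← differentiableOn_univ]
    exact (Complex.differentiableOn_dslope Filter.univ_mem).2 hf.differentiableOn
  have hfd : ∀ z, f z = (z - ρ) * d z := by
    intro z
    have := sub_smul_dslope f ρ z
    simp [hρ] at this
    exact this.symm
  have hden : ∀ z ∈ ball (0 : ℂ) r, ((R : ℂ) ^ 2 - star ρ * z) ≠ 0 := by
    intro z hz h
    have h1 : (R : ℂ) ^ 2 = star ρ * z := sub_eq_zero.1 h
    have h2 := congrArg norm h1
    have hz' : ‖z‖ < r := by simpa using hz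
    rw [norm_mul, norm_star, norm_pow, Complex.norm_real, Real.norm_of_nonneg hR.le] at h2
    nlinarith [norm_nonneg z, norm_nonneg ρ]
  refine ⟨fun z => ((R : ℂ) ^ 2 - star ρ * z) / R * d z, by fun_prop, ?_, ?_, ?_, ?_⟩
  · have hfr : ∀ z ∈ frontier (ball (0 : ℂ) R), ‖((R : ℂ) ^ 2 - star ρ * z) / R * d z‖ ≤ B := by
      intro z hz
      rw [frontier_ball _ hR.ne'] at hz
      have hzR : ‖z‖ = R := by simpa using hz
      have h1 : (R : ℂ) ^ 2 = star z * z := by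
        have := Complex.conj_mul' z
        rw [hzR] at this
        exact this.symm
      have h2 : ‖((R : ℂ) ^ 2 - star ρ * z) / R * d z‖ = ‖f z‖ := by
        rw [h1, ← sub_mul, hfd, norm_mul, norm_mul, norm_div, norm_mul, ← star_sub, norm_star, hzR,
          Complex.norm_real, Real.norm_of_nonneg hR.le]
        field_simp
      rw [h2]
      exact hB z (by simp [hzR])
    intro z hz
    refine Complex.norm_le_of_forall_mem_frontier_norm_le isBounded_ball
      (Differentiable.diffContOnCl (by fun_prop)) hfr ?_
    rwa [closure_ball _ hR.ne']
  · have h1 : ‖f 0‖ = ‖ρ‖ * ‖d 0‖ := by rw [hfd]; simp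
    have h2 : ‖((R : ℂ) ^ 2 - star ρ * 0) / R * d 0‖ = R * ‖d 0‖ := by
      rw [mul_zero, sub_zero, norm_mul, norm_div, norm_pow, Complex.norm_real,
        Real.norm_of_nonneg hR.le]
      field_simp
    rw [h2, h1]
    have h3 : ‖ρ‖ * (R / r) ≤ R := by
      rw [← mul_div_assoc, div_le_iff₀ hr]
      nlinarith
    nlinarith [norm_nonneg (d 0)]
  · intro z hz hk
    have hRc : (R : ℂ) ≠ 0 := by exact_mod_cast hR.ne'
    have := (mul_eq_zero.1 hk).resolve_left (div_ne_zero (hden z hz) hRc)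
    rw [hfd, this, mul_zero]
  · intro z hz hfz
    have hRc : (R : ℂ) ≠ 0 := by exact_mod_cast hR.ne'
    have hzρ : z - ρ ≠ 0 := fun h => hfz (by rw [hfd, h, zero_mul])
    have hdz : d z ≠ 0 := fun h => hfz (by rw [hfd, h, mul_zero])
    have hq : ((R : ℂ) ^ 2 - star ρ * z) / R ≠ 0 := div_ne_zero (hden z hz) hRc
    refine ⟨mul_ne_zero hq hdz, ?_⟩
    have e1 : logDeriv f z = 1 / (z - ρ) + logDeriv d z := by
      have : f = fun z => (z - ρ) * d z := funext hfd
      rw [this, logDeriv_mul z hzρ hdz (by fun_prop) hdd.differentiableAt]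
      congr 1
      simp [logDeriv_apply]
    have e2 : logDeriv (fun z => ((R : ℂ) ^ 2 - star ρ * z) / R) z
        = - (star ρ / (R ^ 2 - star ρ * z)) := by
      have hder : HasDerivAt (fun z => ((R : ℂ) ^ 2 - star ρ * z) / R) (-(star ρ) / R) z := by
        have := (((hasDerivAt_id z).const_mul (star ρ)).const_sub ((R : ℂ) ^ 2)).div_const (R : ℂ)
        simpa using this
      rw [logDeriv_apply, hder.deriv]
      field_simp
    rw [logDeriv_mul z hq hdz (by fun_prop) hdd.differentiableAt, e1, e2]
    ring

-- A Jensen-type zero count by induction. Each Blaschke division keeps the bound $B$ on the large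
-- disc but multiplies the value at the centre by at least $R/r$, so $B\le|f(0)|(R/r)^n$ leaves room
-- for at most $n$ divisions.
open Complex Metric in
theorem exists_zeros_logDeriv_eq (n : ℕ) : ∀ {f : ℂ → ℂ}, Differentiable ℂ f → ∀ {R r B : ℝ},
    0 < r → r < R → f 0 ≠ 0 → (∀ z ∈ closedBall (0 : ℂ) R, ‖f z‖ ≤ B) →
    B ≤ ‖f 0‖ * (R / r) ^ n →
    ∃ (N : ℕ) (ρ : Fin N → ℂ) (h : ℂ → ℂ), N ≤ n ∧ (∀ i, f (ρ i) = 0 ∧ ‖ρ i‖ < r) ∧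
      Differentiable ℂ h ∧ (∀ z ∈ closedBall (0 : ℂ) R, ‖h z‖ ≤ B) ∧ ‖f 0‖ ≤ ‖h 0‖ ∧
      (∀ z ∈ ball (0 : ℂ) r, h z ≠ 0) ∧
      ∀ z ∈ ball (0 : ℂ) r, f z ≠ 0 → logDeriv f z = logDeriv h z +
        ∑ i, (1 / (z - ρ i) + star (ρ i) / (R ^ 2 - star (ρ i) * z)) := by
  induction n with
  | zero =>
    intro f hf R r B hr hrR h0 hB hn
    refine ⟨0, Fin.elim0, f, le_rfl, fun i => i.elim0, hf, hB, le_rfl, ?_, ?_⟩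
    · intro z hz hfz
      obtain ⟨k, -, hk, hk0, -⟩ :=
        exists_blaschke_quotient hf hr hrR h0 hB hfz (by simpa using hz)
      have h1 := hk 0 (by simp [(hr.trans hrR).le])
      have h2 : 1 < R / r := (one_lt_div hr).2 hrR
      have h3 : 0 < ‖f 0‖ := norm_pos_iff.2 h0
      simp only [pow_zero, mul_one] at hn
      nlinarith
    · simp
  | succ n ih =>
    intro f hf R r B hr hrR h0 hB hn
    by_cases hz : ∃ ρ ∈ ball (0 : ℂ) r, f ρ = 0
    · obtain ⟨ρ₀, hρ₀, hfρ₀⟩ := hz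
      obtain ⟨k, hkd, hk, hk0, hkz, hkl⟩ :=
        exists_blaschke_quotient hf hr hrR h0 hB hfρ₀ (by simpa using hρ₀)
      have h2 : 1 < R / r := (one_lt_div hr).2 hrR
      have h3 : 0 < ‖f 0‖ := norm_pos_iff.2 h0
      have h4 : ‖f 0‖ ≤ ‖k 0‖ := by nlinarith
      obtain ⟨N, ρ, h, hN, hρ, hhd, hhB, hh0, hhz, hhl⟩ := ih hkd hr hrR
        (norm_pos_iff.1 (h3.trans_le h4)) hk (hn.trans (by
          rw [pow_succ', ← mul_assoc]; gcongr))
      refine ⟨N + 1, Fin.cons ρ₀ ρ, h, by omega, ?_, hhd, hhB, h4.trans hh0, hhz, ?_⟩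
      · intro i
        refine Fin.cases ⟨hfρ₀, by simpa using hρ₀⟩ (fun i => ?_) i
        exact ⟨hkz _ (by simpa using (hρ i).2) (hρ i).1, (hρ i).2⟩
      · intro z hz hfz
        obtain ⟨hkz0, hl⟩ := hkl z hz hfz
        rw [hl, hhl z hz hkz0, Fin.sum_univ_succ]
        simp only [Fin.cons_zero, Fin.cons_succ]
        ring
    · push Not at hz
      exact ⟨0, Fin.elim0, f, by omega, fun i => i.elim0, hf, hB, le_rfl, hz, by simp⟩

-- A zero-free $h$ on a disc equals $h(0)e^{g}$ with $g(0)=0$ and $\Re g\le M$. Borel–Carathéodory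
-- then bounds $|g|$, and Cauchy's estimate on a circle of radius $\delta$ bounds $g'=h'/h$.
open Complex Metric in
theorem norm_logDeriv_le_of_ne_zero {h : ℂ → ℂ} (hd : Differentiable ℂ h) {r M : ℝ} (hr : 0 < r)
    (hM : 0 < M) (hz : ∀ z ∈ ball (0 : ℂ) r, h z ≠ 0)
    (hB : ∀ z ∈ ball (0 : ℂ) r, ‖h z‖ ≤ Real.exp M * ‖h 0‖) {z : ℂ} {δ : ℝ} (hδ : 0 < δ)
    (hzr : ‖z‖ + 2 * δ ≤ r) : ‖logDeriv h z‖ ≤ 2 * M * r / δ ^ 2 := by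
  have hdl : DifferentiableOn ℂ (logDeriv h) (ball 0 r) := by
    intro w hw
    have : DifferentiableAt ℂ (fun z => deriv h z / h z) w :=
      (hd.deriv w).div (hd w) (hz w hw)
    exact this.differentiableWithinAt
  obtain ⟨g, hg0, hg⟩ := (hdl.isExactOn_ball).with_val_at 0 0
  have h00 : h 0 ≠ 0 := hz 0 (by simpa using hr)
  have key : ∀ w ∈ ball (0 : ℂ) r, h w = h 0 * exp (g w) := by
    intro w hw
    have hc : ∀ w ∈ ball (0 : ℂ) r, HasDerivAt (fun w => h w * exp (-g w)) 0 w := by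
      intro w hw
      have h1 := (hd w).hasDerivAt.mul ((hg w hw).neg.cexp)
      refine h1.congr_deriv ?_
      rw [logDeriv_apply]
      have := hz w hw
      field_simp
      ring
    have hconst := (convex_ball (0 : ℂ) r).is_const_of_fderivWithin_eq_zero (𝕜 := ℂ)
      (f := fun w => h w * exp (-g w))
      (fun w hw => (hc w hw).differentiableAt.differentiableWithinAt)
      (fun w hw => by
        rw [fderivWithin_of_isOpen isOpen_ball hw]
        ext
        simp [(hc w hw).deriv])
      hw (by simpa using hr : (0 : ℂ) ∈ ball (0 : ℂ) r)
    simp only [hg0, neg_zero, exp_zero, mul_one] at hconst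
    rw [← hconst, mul_assoc, ← exp_add]
    simp
  have hre : Set.MapsTo g (ball 0 r) {z | z.re ≤ M} := by
    intro w hw
    have h1 := hB w hw
    rw [key w hw, norm_mul, mul_comm, Complex.norm_exp] at h1
    exact Real.exp_le_exp.1 (le_of_mul_le_mul_right h1 (norm_pos_iff.2 h00))
  have hgd : DifferentiableOn ℂ g (ball 0 r) :=
    fun w hw => (hg w hw).differentiableAt.differentiableWithinAt
  have hsph : ∀ w ∈ closedBall z δ, ‖w‖ ≤ r - δ := by
    intro w hw
    have : ‖w - z‖ ≤ δ := by simpa [dist_eq_norm] using hw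
    have h2 := norm_le_norm_add_norm_sub' w z
    linarith
  have hin : closedBall z δ ⊆ ball 0 r := fun w hw => by
    have := hsph w hw
    simp only [mem_ball, dist_zero_right]; linarith
  have hbound : ∀ w ∈ sphere z δ, ‖g w‖ ≤ 2 * M * r / δ := by
    intro w hw
    have hw' := sphere_subset_closedBall hw
    have h1 := borelCaratheodory_zero hM hgd hre hr (hin hw') hg0
    have h2 := hsph w hw'
    refine h1.trans ?_
    have : 0 ≤ ‖w‖ := norm_nonneg w
    gcongr <;> linarith
  have h5 := Complex.norm_deriv_le_of_forall_mem_sphere_norm_le hδ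
    (DifferentiableOn.diffContOnCl (by
      rw [closure_ball _ hδ.ne']; exact hgd.mono hin)) hbound
  rw [(hg z (hin (by simp [hδ.le]))).deriv] at h5
  refine h5.trans (le_of_eq ?_)
  field_simp

open Complex Metric in
/-- Local partial fraction expansion of the logarithmic derivative of an entire function. -/
theorem exists_logDeriv_partial_fractions {f : ℂ → ℂ} (hf : Differentiable ℂ f) {M : ℝ}
    (hM : 1 ≤ M) (h0 : f 2 ≠ 0) (hB : ∀ z, ‖z - 2‖ ≤ 3 / 2 → ‖f z‖ ≤ Real.exp M * ‖f 2‖) :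
    ∃ (N : ℕ) (ρ : Fin N → ℂ) (E : ℂ → ℂ), (N : ℝ) ≤ 7 * M ∧
      (∀ i, f (ρ i) = 0 ∧ ‖ρ i - 2‖ < 5 / 4) ∧
      DifferentiableOn ℂ E (ball 2 (5 / 4)) ∧ (∀ z, ‖z - 2‖ ≤ 9 / 8 → ‖E z‖ ≤ 1000 * M) ∧
      ∀ z, ‖z - 2‖ < 5 / 4 → f z ≠ 0 → logDeriv f z = E z + ∑ i, 1 / (z - ρ i) := by
  set F : ℂ → ℂ := fun z => f (z + 2) with hF
  have hFd : Differentiable ℂ F := by fun_prop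
  have hlog : ∀ z, logDeriv F z = logDeriv f (z + 2) := by
    intro z
    simp [logDeriv_apply, hF, deriv_comp_add_const]
  have hB' : ∀ z ∈ closedBall (0 : ℂ) (3 / 2), ‖F z‖ ≤ Real.exp M * ‖F 0‖ := by
    intro z hz
    simpa [hF] using hB (z + 2) (by simpa using hz)
  -- The radii $3/2$ and $5/4$ have ratio $6/5$, and $e\le(6/5)^6$, so about $6M$ divisions exhaust
  -- the growth $e^M$.
  have hpow : Real.exp M ≤ ((3 / 2 : ℝ) / (5 / 4)) ^ ⌈6 * M⌉₊ := by
    have h1 : Real.exp 1 ≤ (6 / 5 : ℝ) ^ 6 := by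
      have := Real.exp_one_lt_d9; norm_num at this ⊢; linarith
    calc Real.exp M = Real.exp 1 ^ M := by rw [← Real.exp_mul, one_mul]
      _ ≤ ((6 / 5 : ℝ) ^ 6) ^ M := Real.rpow_le_rpow (Real.exp_pos _).le h1 (by linarith)
      _ = (6 / 5 : ℝ) ^ (6 * M) := by
        rw [← Real.rpow_natCast, ← Real.rpow_mul (by norm_num)]; norm_num
      _ ≤ (6 / 5 : ℝ) ^ ((⌈6 * M⌉₊ : ℕ) : ℝ) :=
        Real.rpow_le_rpow_of_exponent_le (by norm_num) (Nat.le_ceil _)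
      _ = _ := by rw [Real.rpow_natCast]; norm_num
  obtain ⟨N, ρ, h, hN, hρ, hhd, hhB, hh0, hhz, hl⟩ := exists_zeros_logDeriv_eq ⌈6 * M⌉₊ hFd
    (R := 3 / 2) (r := 5 / 4) (by norm_num) (by norm_num) (by simpa [hF] using h0) hB' (by
      rw [mul_comm]; gcongr)
  have hN' : (N : ℝ) ≤ 7 * M := by
    have h1 : (N : ℝ) ≤ (⌈6 * M⌉₊ : ℕ) := by exact_mod_cast hN
    have h2 := Nat.ceil_lt_add_one (by linarith : 0 ≤ 6 * M)
    linarith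
  -- The reflected halves of the Blaschke terms are harmless: their poles lie outside the large
  -- disc, and $9/4-(5/4)^2\ge1/2$ bounds the denominators below. They join the holomorphic part.
  set Q : ℂ → ℂ := fun z => ∑ i, star (ρ i) / (((3 / 2 : ℝ) : ℂ) ^ 2 - star (ρ i) * z) with hQ
  have hnorm : ∀ i, ∀ z : ℂ, ‖z‖ < 5 / 4 →
      (1 / 2 : ℝ) ≤ ‖((3 / 2 : ℝ) : ℂ) ^ 2 - star (ρ i) * z‖ := by
    intro i z hz
    have h1 := norm_sub_norm_le (((3 / 2 : ℝ) : ℂ) ^ 2) (star (ρ i) * z)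
    have h2 : ‖((3 / 2 : ℝ) : ℂ) ^ 2‖ = 9 / 4 := by
      rw [norm_pow, Complex.norm_real]; norm_num
    rw [h2, norm_mul, norm_star] at h1
    nlinarith [(hρ i).2, norm_nonneg z, norm_nonneg (ρ i)]
  have hQd : DifferentiableOn ℂ Q (ball 0 (5 / 4)) := by
    intro z hz
    refine DifferentiableAt.differentiableWithinAt ?_
    refine DifferentiableAt.fun_sum fun i _ => ?_
    refine DifferentiableAt.div (by fun_prop) (by fun_prop) fun h => ?_
    have := hnorm i z (by simpa using hz)
    rw [h, norm_zero] at this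
    norm_num at this
  have hQb : ∀ z : ℂ, ‖z‖ < 5 / 4 → ‖Q z‖ ≤ 18 * M := by
    intro z hz
    refine (norm_sum_le _ _).trans ?_
    have : ∀ i ∈ Finset.univ, ‖star (ρ i) / (((3 / 2 : ℝ) : ℂ) ^ 2 - star (ρ i) * z)‖ ≤ 5 / 2 := by
      intro i _
      rw [norm_div, norm_star, div_le_iff₀ (by linarith [hnorm i z hz])]
      linarith [(hρ i).2, hnorm i z hz]
    refine (Finset.sum_le_card_nsmul _ _ _ this).trans ?_
    simp
    linarith
  refine ⟨N, fun i => ρ i + 2, fun z => logDeriv h (z - 2) + Q (z - 2), hN', ?_, ?_, ?_, ?_⟩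
  · intro i
    exact ⟨(hρ i).1, by simpa using (hρ i).2⟩
  · intro z hz
    have hz' : z - 2 ∈ ball (0 : ℂ) (5 / 4) := by simpa [dist_eq_norm] using hz
    have h1 : DifferentiableAt ℂ (fun z => deriv h z / h z) (z - 2) :=
      (hhd.deriv _).div (hhd _) (hhz _ hz')
    have h2 : DifferentiableAt ℂ Q (z - 2) := hQd.differentiableAt (isOpen_ball.mem_nhds hz')
    have h3 : DifferentiableAt ℂ (fun w => (fun z => deriv h z / h z) (w - 2) + Q (w - 2)) z :=
      (DifferentiableAt.comp z (f := fun w : ℂ => w - 2) h1 (by fun_prop)).add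
        (DifferentiableAt.comp z (f := fun w : ℂ => w - 2) h2 (by fun_prop))
    exact h3.differentiableWithinAt
  · intro z hz
    have h1 := norm_logDeriv_le_of_ne_zero hhd (r := 5 / 4) (M := M) (by norm_num) (by linarith)
      hhz (fun w hw => (hhB w (by
        simp only [mem_ball, dist_zero_right, mem_closedBall] at hw ⊢; linarith)).trans
          (by gcongr)) (z := z - 2) (δ := 1 / 16) (by norm_num) (by linarith)
    have h2 := hQb (z - 2) (by linarith)
    refine (norm_add_le _ _).trans ?_
    have : 2 * M * (5 / 4) / (1 / 16) ^ 2 = 640 * M := by ring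
    linarith
  · intro z hz hfz
    have h1 := hl (z - 2) (by simpa using hz) (by simpa [hF] using hfz)
    rw [hlog, sub_add_cancel, Finset.sum_add_distrib] at h1
    rw [h1, hQ, add_assoc, add_comm (Finset.sum _ _) (Finset.sum _ _)]
    congr 2
    refine Finset.sum_congr rfl fun i _ => ?_
    rw [sub_sub, add_comm 2]

/-! ### Uniform bounds for $L(s,\chi)$ and $L'/L(s,\chi)$. -/

-- Sums over a full period vanish by orthogonality, so only an incomplete block of fewer than $N$
-- terms survives. This trivial bound suffices, since only $\log|L|\ll\log N$ matters later.
open DirichletCharacter in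
theorem DirichletCharacter.norm_sum_range_le {N : ℕ} [NeZero N] {χ : DirichletCharacter ℂ N}
    (hχ : χ ≠ 1) (n : ℕ) : ‖∑ k ∈ Finset.range n, χ (k : ZMod N)‖ ≤ N := by
  have hblock : ∀ m : ℕ, ∑ i ∈ Finset.range N, χ ((m + i : ℕ) : ZMod N) = 0 := by
    intro m
    have h1 : ∑ i ∈ Finset.range N, χ ((m + i : ℕ) : ZMod N) = ∑ a : ZMod N, χ ((m : ZMod N) + a) := by
      refine Finset.sum_nbij' (fun i => (i : ZMod N)) ZMod.val (by simp) ?_ ?_ ?_ ?_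
      · intro a _; simpa using ZMod.val_lt a
      · intro i hi; exact ZMod.val_cast_of_lt (by simpa using hi)
      · intro a _; simp
      · intro i _; simp
    rw [h1]
    exact (Equiv.sum_comp (Equiv.addLeft (m : ZMod N)) (fun a => χ a)).trans
      (MulChar.sum_eq_zero_of_ne_one hχ)
  induction n using Nat.strong_induction_on with
  | _ n ih =>
    rcases lt_or_ge n N with h | h
    · refine (norm_sum_le _ _).trans ((Finset.sum_le_sum fun k _ => χ.norm_le_one _).trans ?_)
      simpa using h.le
    · obtain ⟨m, rfl⟩ := Nat.exists_eq_add_of_le' h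
      rw [Finset.sum_range_add, hblock, add_zero]
      exact ih m (by have := NeZero.pos N; omega)

theorem DirichletCharacter.norm_sum_Icc_le {N : ℕ} [NeZero N] {χ : DirichletCharacter ℂ N}
    (hχ : χ ≠ 1) (n : ℕ) : ‖∑ k ∈ Finset.Icc 1 n, χ (k : ZMod N)‖ ≤ 2 * N := by
  have h1 : ∑ k ∈ Finset.range (n + 1), χ (k : ZMod N)
      = χ ((0 : ℕ) : ZMod N) + ∑ k ∈ Finset.Icc 1 n, χ (k : ZMod N) := by
    rw [Finset.range_eq_Ico, Finset.sum_eq_sum_Ico_succ_bot (by omega)]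
    rfl
  have h2 : ∑ k ∈ Finset.Icc 1 n, χ (k : ZMod N)
      = ∑ k ∈ Finset.range (n + 1), χ (k : ZMod N) - χ ((0 : ℕ) : ZMod N) := by
    rw [h1]; ring
  rw [h2]
  have h3 := norm_sum_range_le hχ (n + 1)
  have h4 := χ.norm_le_one ((0 : ℕ) : ZMod N)
  have h5 : (1 : ℝ) ≤ N := by exact_mod_cast NeZero.one_le
  refine (norm_sub_le _ _).trans ?_
  linarith

open Complex MeasureTheory Set Filter Asymptotics Topology in
/-- The integral representation of `L(s, χ)` from partial summation, valid for `0 < re s`. -/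
theorem DirichletCharacter.LFunction_eq_mul_integral {N : ℕ} [NeZero N]
    {χ : DirichletCharacter ℂ N} (hχ : χ ≠ 1) {s : ℂ} (hs : 0 < s.re) :
    LFunction χ s =
      s * ∫ t in Ioi (1 : ℝ), (∑ k ∈ Finset.Icc 1 ⌊t⌋₊, χ (k : ZMod N)) * (t : ℂ) ^ (-(s + 1)) := by
  set S : ℝ → ℂ := fun t => ∑ k ∈ Finset.Icc 1 ⌊t⌋₊, χ (k : ZMod N) with hS
  -- Cutting off below $1$ turns the integral into a Mellin transform at $-s$, whose holomorphy for
  -- $\Re s>0$ follows from boundedness of the character sums.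
  set f : ℝ → ℂ := (Ioi (1 : ℝ)).indicator S with hf
  have hSm : Measurable S :=
    (measurable_from_nat (f := fun n : ℕ => ∑ k ∈ Finset.Icc 1 n, χ (k : ZMod N))).comp
      Nat.measurable_floor
  have hfm : Measurable f := hSm.indicator measurableSet_Ioi
  have hfb : ∀ t, ‖f t‖ ≤ 2 * N := fun t =>
    (norm_indicator_le_norm_self _ _).trans (norm_sum_Icc_le hχ _)
  have hfl : LocallyIntegrableOn f (Ioi 0) := by
    refine LocallyIntegrable.locallyIntegrableOn ?_ _
    refine (locallyIntegrable_const (2 * N : ℝ)).mono hfm.aestronglyMeasurable ?_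
    refine Eventually.of_forall fun t => (hfb t).trans (le_abs_self _)
  have hmel : ∀ s : ℂ, mellin f (-s) = ∫ t in Ioi (1 : ℝ), S t * (t : ℂ) ^ (-(s + 1)) := by
    intro s
    have h1 : ∀ t : ℝ, (t : ℂ) ^ (-s - 1) • f t
        = (Ioi (1 : ℝ)).indicator (fun t : ℝ => S t * (t : ℂ) ^ (-(s + 1))) t := by
      intro t
      by_cases ht : t ∈ Ioi (1 : ℝ)
      · simp only [hf, indicator_of_mem ht, smul_eq_mul]
        rw [mul_comm]; congr 2; ring
      · simp [hf, indicator_of_notMem ht]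
    rw [mellin]
    simp_rw [h1]
    rw [setIntegral_indicator measurableSet_Ioi, inter_eq_right.2 (Ioi_subset_Ioi zero_le_one)]
  have hdiff : ∀ s : ℂ, 0 < s.re → DifferentiableAt ℂ (fun s => s * mellin f (-s)) s := by
    intro s hs
    have h1 : DifferentiableAt ℂ (mellin f) (-s) := by
      refine mellin_differentiableAt_of_isBigO_rpow (a := 0) (b := -s.re - 1) hfl ?_ (by simpa)
        ?_ (by simp)
      · refine IsBigO.of_bound (2 * N) (Eventually.of_forall fun t => ?_)
        simpa using hfb t
      · refine IsBigO.of_bound 0 ?_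
        filter_upwards [Ioo_mem_nhdsGT (zero_lt_one (α := ℝ))] with t ht
        rw [hf, indicator_of_notMem (by simp [ht.2.le])]
        simp
    exact differentiableAt_id.mul (DifferentiableAt.comp s (f := fun s => -s) h1 (by fun_prop))
  have hopen : IsOpen {s : ℂ | 0 < s.re} := isOpen_lt continuous_const continuous_re
  -- Both sides are holomorphic on the half plane and agree near $2$, where the Dirichlet series
  -- converges; the identity theorem extends this to $\Re s>0$.
  have heq : EqOn (LFunction χ) (fun s => s * mellin f (-s)) {s : ℂ | 0 < s.re} := by
    refine AnalyticOnNhd.eqOn_of_preconnected_of_eventuallyEq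
      ((differentiable_LFunction hχ).differentiableOn.analyticOnNhd hopen)
      (DifferentiableOn.analyticOnNhd
        (fun s hs => (hdiff s hs).differentiableWithinAt) hopen)
      (convex_halfSpace_re_gt 0).isPreconnected (z₀ := 2) (by simp) ?_
    have h2 : {s : ℂ | 1 < s.re} ∈ 𝓝 (2 : ℂ) :=
      (isOpen_lt continuous_const continuous_re).mem_nhds (by simp)
    filter_upwards [h2] with s hs
    rw [hmel, LFunction_eq_LSeries χ hs]
    refine LSeries_eq_mul_integral _ le_rfl (zero_lt_one.trans hs)
      (LSeriesSummable_of_one_lt_re χ hs) ?_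
    refine IsBigO.of_bound (2 * N) (Eventually.of_forall fun n => ?_)
    simpa using norm_sum_Icc_le hχ n
  rw [heq hs]
  beta_reduce
  rw [hmel]

open Complex MeasureTheory Set in
theorem DirichletCharacter.norm_LFunction_le {N : ℕ} [NeZero N]
    {χ : DirichletCharacter ℂ N} (hχ : χ ≠ 1) {s : ℂ} (hs : 0 < s.re) :
    ‖LFunction χ s‖ ≤ ‖s‖ * (2 * N / s.re) := by
  rw [LFunction_eq_mul_integral hχ hs, norm_mul]
  gcongr
  have hint : IntegrableOn (fun t : ℝ => 2 * (N : ℝ) * t ^ (-s.re - 1)) (Ioi 1) :=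
    (integrableOn_Ioi_rpow_of_lt (by linarith) zero_lt_one).const_mul _
  refine (norm_integral_le_of_norm_le hint ?_).trans (le_of_eq ?_)
  · refine (ae_restrict_iff' measurableSet_Ioi).2 (Filter.Eventually.of_forall fun t ht => ?_)
    have ht0 : 0 < t := zero_lt_one.trans ht
    rw [norm_mul, Complex.norm_cpow_eq_rpow_re_of_pos ht0]
    have h1 := norm_sum_Icc_le hχ ⌊t⌋₊
    have h2 : (-(s + 1)).re = -s.re - 1 := by simp; ring
    rw [h2]
    gcongr
  · rw [integral_const_mul, integral_Ioi_rpow_of_lt (by linarith) zero_lt_one]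
    simp
    field_simp

-- The term $n=1$ is $1$ and the others total at most $\pi^2/6-1<2/3$. This makes $2$ a good centre
-- for the disc estimates, uniformly in $\chi$.
open Complex in
theorem DirichletCharacter.one_third_le_norm_LFunction_two {N : ℕ} [NeZero N]
    (χ : DirichletCharacter ℂ N) : 1 / 3 ≤ ‖LFunction χ 2‖ := by
  have h2 : (1 : ℝ) < (2 : ℂ).re := by simp
  rw [LFunction_eq_LSeries χ h2, LSeries]
  have hsum : Summable (LSeries.term (fun n => χ (n : ZMod N)) 2) :=
    LSeriesSummable_of_one_lt_re χ h2
  have hz : HasSum (fun n : ℕ => 1 / (n : ℝ) ^ 2) (Real.pi ^ 2 / 6) := hasSum_zeta_two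
  have hb : ∀ n : ℕ, ‖LSeries.term (fun n => χ (n : ZMod N)) 2 n‖ ≤ 1 / (n : ℝ) ^ 2 := by
    intro n
    rcases eq_or_ne n 0 with rfl | hn
    · simp
    · rw [LSeries.term_of_ne_zero hn, norm_div]
      have : ‖(n : ℂ) ^ (2 : ℂ)‖ = (n : ℝ) ^ 2 := by
        rw [show (2 : ℂ) = ((2 : ℕ) : ℂ) by norm_num, cpow_natCast, norm_pow, norm_natCast]
      rw [this]
      gcongr
      exact χ.norm_le_one _
  have e1 := hsum.sum_add_tsum_nat_add 2
  have e2 : ∑ i ∈ Finset.range 2, LSeries.term (fun n => χ (n : ZMod N)) 2 i = 1 := by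
    simp [Finset.sum_range_succ, LSeries.term]
  have e3 := hz.summable.sum_add_tsum_nat_add 2
  rw [hz.tsum_eq] at e3
  have e4 : ∑ i ∈ Finset.range 2, 1 / ((i : ℕ) : ℝ) ^ 2 = 1 := by
    simp [Finset.sum_range_succ]
  rw [e4] at e3
  rw [e2] at e1
  have e5 : ‖∑' n : ℕ, LSeries.term (fun n => χ (n : ZMod N)) 2 (n + 2)‖
      ≤ ∑' n : ℕ, 1 / ((n + 2 : ℕ) : ℝ) ^ 2 :=
    tsum_of_norm_bounded ((summable_nat_add_iff 2).2 hz.summable).hasSum fun n => hb (n + 2)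
  rw [← e1]
  have e6 := norm_sub_le_norm_add (1 : ℂ)
    (∑' n : ℕ, LSeries.term (fun n => χ (n : ZMod N)) 2 (n + 2))
  rw [norm_one] at e6
  have hpi : Real.pi < 3.15 := Real.pi_lt_d2
  have hpi0 := Real.pi_pos
  have : Real.pi ^ 2 / 6 ≤ 5 / 3 := by nlinarith
  linarith

-- After removal of the simple pole at $1$, $-\zeta'/\zeta$ is continuous on $[1,2]$, hence bounded
-- there by compactness. The terms of the series are nonnegative at real $\sigma$, so its value is
-- also the sum of norms.
open Complex ArithmeticFunction Set in
theorem exists_tsum_vonMangoldt_le : ∃ C : ℝ, 1 ≤ C ∧ ∀ σ : ℝ, 1 < σ → σ ≤ 2 →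
    Summable (fun n : ℕ => ‖LSeries.term (fun n => (vonMangoldt n : ℂ)) σ n‖) ∧
    ∑' n : ℕ, ‖LSeries.term (fun n => (vonMangoldt n : ℂ)) σ n‖ ≤ C / (σ - 1) := by
  have hcont : ContinuousOn (fun σ : ℝ =>
      -deriv (DirichletCharacter.LFunctionTrivChar₁ 1) (σ : ℂ) /
        DirichletCharacter.LFunctionTrivChar₁ 1 (σ : ℂ)) (Icc 1 2) := by
    refine (DirichletCharacter.continuousOn_neg_logDeriv_LFunctionTrivChar₁ 1).comp
      (f := fun σ : ℝ => (σ : ℂ)) (by fun_prop) ?_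
    intro σ hσ
    rcases eq_or_lt_of_le hσ.1 with h | h
    · left; simp [← h]
    · right
      exact DirichletCharacter.LFunction_ne_zero_of_one_le_re _
        (Or.inr (ofReal_ne_one.2 h.ne')) (by simpa using hσ.1)
  obtain ⟨C, hC⟩ := isCompact_Icc.exists_bound_of_continuousOn hcont
  refine ⟨|C| + 1, by linarith [abs_nonneg C], fun σ h1 h2 => ?_⟩
  have hσ : 1 < (σ : ℂ).re := by simpa using h1
  have hs : LSeriesSummable (fun n => (vonMangoldt n : ℂ)) σ := LSeriesSummable_vonMangoldt hσ
  refine ⟨hs.norm, ?_⟩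
  have hterm : ∀ n, LSeries.term (fun n => (vonMangoldt n : ℂ)) σ n
      = ((‖LSeries.term (fun n => (vonMangoldt n : ℂ)) σ n‖ : ℝ) : ℂ) := by
    intro n
    rcases eq_or_ne n 0 with rfl | hn
    · simp
    · rw [LSeries.term_of_ne_zero hn, norm_div, norm_natCast_cpow_of_pos (by omega),
        Complex.norm_real, Real.norm_of_nonneg vonMangoldt_nonneg]
      push_cast
      rw [ofReal_cpow (by positivity)]
      simp
  have hsum : ((∑' n : ℕ, ‖LSeries.term (fun n => (vonMangoldt n : ℂ)) σ n‖ : ℝ) : ℂ)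
      = LSeries (fun n => (vonMangoldt n : ℂ)) σ := by
    rw [LSeries, Complex.ofReal_tsum]
    exact tsum_congr fun n => (hterm n).symm
  have hσ1 : (σ : ℂ) ≠ 1 := by exact_mod_cast h1.ne'
  have hσ1' : (σ : ℂ) - 1 ≠ 0 := sub_ne_zero.2 hσ1
  have hζ : riemannZeta σ ≠ 0 := riemannZeta_ne_zero_of_one_lt_re hσ
  have e1 : DirichletCharacter.LFunctionTrivChar 1 = riemannZeta :=
    DirichletCharacter.LFunction_modOne_eq
  have e2 : LSeries (fun n => (vonMangoldt n : ℂ)) σ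
      = -deriv (DirichletCharacter.LFunctionTrivChar₁ 1) (σ : ℂ) /
        DirichletCharacter.LFunctionTrivChar₁ 1 (σ : ℂ) + 1 / (σ - 1) := by
    rw [LSeries_vonMangoldt_eq_deriv_riemannZeta_div hσ,
      DirichletCharacter.deriv_LFunctionTrivChar₁_apply_of_ne_one 1 hσ1,
      DirichletCharacter.LFunctionTrivChar₁, Function.update_of_ne hσ1, e1]
    field_simp
    ring
  have h3 := hC σ ⟨h1.le, h2⟩
  have h4 : ‖((∑' n : ℕ, ‖LSeries.term (fun n => (vonMangoldt n : ℂ)) σ n‖ : ℝ) : ℂ)‖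
      ≤ C + 1 / (σ - 1) := by
    rw [hsum, e2]
    refine (norm_add_le _ _).trans (add_le_add h3 (le_of_eq ?_))
    rw [norm_div, norm_one, ← ofReal_one, ← ofReal_sub, Complex.norm_real,
      Real.norm_of_nonneg (by linarith)]
  rw [Complex.norm_real] at h4
  refine (le_abs_self _).trans (h4.trans ?_)
  have h5 : 0 < σ - 1 := by linarith
  rw [add_div]
  gcongr
  rw [le_div_iff₀ h5]
  nlinarith [le_abs_self C, abs_nonneg C]

open Complex ArithmeticFunction in
theorem DirichletCharacter.logDeriv_LFunction_eq {N : ℕ} [NeZero N] (χ : DirichletCharacter ℂ N)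
    {s : ℂ} (hs : 1 < s.re) :
    logDeriv (LFunction χ) s = -LSeries (fun n => χ (n : ZMod N) * (vonMangoldt n : ℂ)) s := by
  have h1 := LSeries_twist_vonMangoldt_eq χ hs
  rw [logDeriv_apply, deriv_LFunction_eq_deriv_LSeries χ hs, LFunction_eq_LSeries χ hs]
  have h2 : LSeries (fun n => χ (n : ZMod N) * (vonMangoldt n : ℂ)) s
    = LSeries ((fun n : ℕ => χ (n : ZMod N)) * fun n => (vonMangoldt n : ℂ)) s := rfl
  rw [h2, h1]
  ring

open Complex ArithmeticFunction in
theorem DirichletCharacter.norm_term_twist_le {N : ℕ} (χ : DirichletCharacter ℂ N) (s : ℂ) (n : ℕ) :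
    ‖LSeries.term (fun n => χ (n : ZMod N) * (vonMangoldt n : ℂ)) s n‖
      ≤ ‖LSeries.term (fun n => (vonMangoldt n : ℂ)) (s.re : ℂ) n‖ := by
  rcases eq_or_ne n 0 with rfl | hn
  · simp
  · rw [LSeries.term_of_ne_zero hn, LSeries.term_of_ne_zero hn, norm_div, norm_div,
      norm_natCast_cpow_of_pos (by omega), norm_natCast_cpow_of_pos (by omega), ofReal_re, norm_mul]
    gcongr
    exact mul_le_of_le_one_left (norm_nonneg _) (χ.norm_le_one _)

-- The Dirichlet series of $L'/L$ is dominated termwise by that of $-\zeta'/\zeta$ at $\Re s$, so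
-- the constant is independent of the character.
open Complex ArithmeticFunction in
theorem exists_norm_logDeriv_LFunction_le : ∃ C : ℝ, 1 ≤ C ∧
    ∀ {N : ℕ} [NeZero N] (χ : DirichletCharacter ℂ N) (s : ℂ), 1 < s.re → s.re ≤ 2 →
      ‖logDeriv (DirichletCharacter.LFunction χ) s‖ ≤ C / (s.re - 1) := by
  obtain ⟨C, hC1, hC⟩ := exists_tsum_vonMangoldt_le
  refine ⟨C, hC1, fun χ s h1 h2 => ?_⟩
  rw [DirichletCharacter.logDeriv_LFunction_eq χ h1, norm_neg, LSeries]
  exact (tsum_of_norm_bounded (hC s.re h1 h2).1.hasSum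
    (χ.norm_term_twist_le s)).trans (hC s.re h1 h2).2

/-! ### Partial fractions of $L'/L$ near $1$ under the zero-free hypothesis. -/

open Complex Metric in
/-- Under the zero-free region hypothesis, `L'/L` has a local partial fraction expansion near `1`
over zeros `ρ` with `∑ |ρ - 1|⁻² ≪ (log N)²`. -/
theorem exists_LFunction_partial_fractions {c : ℝ} (hc : 0 < c) : ∃ C : ℝ, 1 ≤ C ∧
    ∀ {D : ℕ} [NeZero D], 3 < D → ∀ χ : DirichletCharacter ℂ D, χ ≠ 1 →
      HypothesisH (DirichletCharacter.LFunction χ) D c →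
      ∃ (N : ℕ) (ρ : Fin N → ℂ) (E : ℂ → ℂ), (N : ℝ) ≤ C * Real.log D ∧
        (∀ i, (ρ i).re ≤ 1 - c / Real.log D) ∧
        ∑ i, (‖ρ i - 1‖ ^ 2)⁻¹ ≤ C * Real.log D ^ 2 ∧
        DifferentiableOn ℂ E (ball 2 (5 / 4)) ∧
        (∀ z, ‖z - 2‖ ≤ 9 / 8 → ‖E z‖ ≤ C * Real.log D) ∧
        ∀ z, ‖z - 2‖ < 5 / 4 → 1 < z.re →
          logDeriv (DirichletCharacter.LFunction χ) z = E z + ∑ i, 1 / (z - ρ i) := by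
  obtain ⟨C₀, hC₀, hlog⟩ := exists_norm_logDeriv_LFunction_le
  refine ⟨(1 + 1 / c) ^ 2 * (C₀ + 4000), ?_, ?_⟩
  · have : 1 ≤ 1 + 1 / c := by have : 0 < 1 / c := by positivity
                               linarith
    nlinarith
  intro D _ hD χ hχ hH
  have hDr : (4 : ℝ) ≤ D := by exact_mod_cast hD
  set l := Real.log D with hl
  have hl1 : 1 ≤ l := by
    rw [hl, Real.le_log_iff_exp_le (by linarith)]
    have := Real.exp_one_lt_d9
    linarith
  have hl0 : 0 < l := by linarith
  have hexp : Real.exp l = D := Real.exp_log (by linarith)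
  have hL2 := DirichletCharacter.one_third_le_norm_LFunction_two χ
  have hC1 : 4000 ≤ (1 + 1 / c) ^ 2 * (C₀ + 4000) := by
    have : 1 ≤ (1 + 1 / c) ^ 2 := one_le_pow₀ (by have : 0 < 1 / c := by positivity
                                                  linarith)
    nlinarith
  -- On the disc $|z-2|\le3/2$ one has $|L|\le14D\le D^4/3\le D^4|L(2,\chi)|$, so $M=4\log D$ is
  -- admissible.
  obtain ⟨N, ρ, E, hN, hρ, hEd, hEb, hE⟩ := exists_logDeriv_partial_fractions
    (DirichletCharacter.differentiable_LFunction hχ) (M := 4 * l) (by linarith)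
    (by intro h; rw [h, norm_zero] at hL2; norm_num at hL2) (by
      intro z hz
      have hre : 1 / 2 ≤ z.re := by
        have := (abs_re_le_norm (z - 2)).trans hz
        simp only [sub_re, re_ofNat] at this
        linarith [(abs_le.1 this).1]
      have hzn : ‖z‖ ≤ 7 / 2 := by
        have := norm_le_norm_add_norm_sub' z 2
        simp at this
        linarith
      refine (DirichletCharacter.norm_LFunction_le hχ (by linarith)).trans ?_
      have h1 : 2 * (D : ℝ) / z.re ≤ 4 * D := by
        rw [div_le_iff₀ (by linarith)]
        nlinarith
      have h2 : Real.exp (4 * l) = (D : ℝ) ^ 4 := by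
        rw [← hexp, ← Real.exp_nat_mul]; norm_num
      have h3 : (64 : ℝ) ≤ (D : ℝ) ^ 3 := by
        have := pow_le_pow_left₀ (by norm_num) hDr 3
        norm_num at this ⊢; linarith
      calc ‖z‖ * (2 * D / z.re) ≤ 7 / 2 * (4 * D) := by gcongr
        _ ≤ (D : ℝ) ^ 4 * (1 / 3) := by nlinarith
        _ ≤ _ := by rw [h2]; gcongr)
  have hre1 : ∀ i, (ρ i).re < 1 := by
    intro i
    by_contra h
    exact DirichletCharacter.LFunction_ne_zero_of_one_le_re χ (Or.inl hχ) (not_lt.1 h) (hρ i).1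
  have hre : ∀ i, (ρ i).re ≤ 1 - c / l := by
    intro i
    -- Since $\Re\rho<1$ and $|\rho-2|<5/4$, the imaginary part satisfies $\gamma^2<25/16-1$, so
    -- $\rho$ lies in the height range of the hypothesis.
    refine hH _ (hρ i).1 ?_
    have h1 : ‖ρ i - 2‖ ^ 2 < (5 / 4) ^ 2 := by
      have := (hρ i).2; gcongr
    rw [← normSq_eq_norm_sq, normSq_apply] at h1
    simp only [sub_re, re_ofNat, sub_im, im_ofNat, sub_zero] at h1
    rw [abs_le]
    constructor <;> nlinarith [hre1 i]
  refine ⟨N, ρ, E, ?_, hre, ?_, hEd, ?_, ?_⟩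
  · refine hN.trans ?_
    nlinarith
  -- At distance $1/l$ to the right of $1$, $L'/L$ is $O(l)$, and so is $\Re\sum 1/(s-\rho)$. Each
  -- summand is at least $l^{-1}|s-\rho|^{-2}$, which yields the second-moment bound.
  · set s : ℂ := ((1 + 1 / l : ℝ) : ℂ) with hs
    have hil : 0 < 1 / l := by positivity
    have hil1 : 1 / l ≤ 1 := by rw [div_le_one hl0]; exact hl1
    have hsre : s.re = 1 + 1 / l := by simp [hs]
    have hs2 : ‖s - 2‖ ≤ 1 := by
      have : s - 2 = ((1 / l - 1 : ℝ) : ℂ) := by rw [hs]; push_cast; ring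
      rw [this, Complex.norm_real, Real.norm_eq_abs, abs_le]
      constructor <;> linarith
    have hne : DirichletCharacter.LFunction χ s ≠ 0 :=
      DirichletCharacter.LFunction_ne_zero_of_one_le_re χ (Or.inl hχ) (by rw [hsre]; linarith)
    have h1 := hE s (by linarith) hne
    have h2 := hlog χ s (by rw [hsre]; linarith) (by rw [hsre]; linarith)
    have h3 := hEb s (by linarith)
    have h4 : (∑ i, 1 / (s - ρ i)).re ≤ (C₀ + 4000) * l := by
      have : ∑ i, 1 / (s - ρ i) = logDeriv (DirichletCharacter.LFunction χ) s - E s := by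
        rw [h1]; ring
      rw [this]
      refine (re_le_norm _).trans ((norm_sub_le _ _).trans ?_)
      rw [hsre] at h2
      have : C₀ / (1 + 1 / l - 1) = C₀ * l := by field_simp; ring
      rw [this] at h2
      linarith
    rw [re_sum] at h4
    have h5 : ∀ i, (‖ρ i - 1‖ ^ 2)⁻¹ ≤ (1 + 1 / c) ^ 2 * l * (1 / (s - ρ i)).re := by
      intro i
      have hcl : 0 < c / l := by positivity
      have a1 : c / l ≤ ‖ρ i - 1‖ := by
        have := abs_re_le_norm (ρ i - 1)
        simp only [sub_re, one_re] at this
        have h6 := neg_le_abs ((ρ i).re - 1)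
        linarith [hre i]
      -- Here the zero-free region is essential: $|\rho-1|\ge c/l$ lets the shift $1/l$ be absorbed,
      -- so the base point may be moved from $s$ to $1$.
      have a2 : ‖s - ρ i‖ ≤ (1 + 1 / c) * ‖ρ i - 1‖ := by
        have : s - ρ i = ((1 / l : ℝ) : ℂ) - (ρ i - 1) := by rw [hs]; push_cast; ring
        rw [this]
        refine (norm_sub_le _ _).trans ?_
        rw [Complex.norm_real, Real.norm_of_nonneg hil.le]
        have : 1 / l ≤ 1 / c * ‖ρ i - 1‖ := by
          calc 1 / l = 1 / c * (c / l) := by field_simp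
            _ ≤ _ := by gcongr
        linarith
      have a3 : 0 < ‖s - ρ i‖ := by
        rw [norm_pos_iff]
        intro h
        have := congrArg re h
        rw [sub_re, hsre, zero_re] at this
        linarith [hre1 i]
      have a4 : 1 / l * (‖s - ρ i‖ ^ 2)⁻¹ ≤ (1 / (s - ρ i)).re := by
        rw [one_div (s - ρ i), inv_re, ← normSq_eq_norm_sq, div_eq_mul_inv _ (normSq _)]
        have a7 : 1 / l ≤ (s - ρ i).re := by
          rw [sub_re, hsre]
          linarith [hre1 i]
        exact mul_le_mul_of_nonneg_right a7 (inv_nonneg.2 (normSq_nonneg _))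
      have a5 : (‖ρ i - 1‖ ^ 2)⁻¹ ≤ (1 + 1 / c) ^ 2 * (‖s - ρ i‖ ^ 2)⁻¹ := by
        have a6 : 0 < ‖ρ i - 1‖ := by linarith
        rw [← div_eq_mul_inv, le_div_iff₀ (by positivity), inv_mul_le_iff₀ (by positivity)]
        calc ‖s - ρ i‖ ^ 2 ≤ ((1 + 1 / c) * ‖ρ i - 1‖) ^ 2 := by gcongr
          _ = _ := by ring
      calc (‖ρ i - 1‖ ^ 2)⁻¹ ≤ (1 + 1 / c) ^ 2 * (‖s - ρ i‖ ^ 2)⁻¹ := a5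
        _ = (1 + 1 / c) ^ 2 * l * (1 / l * (‖s - ρ i‖ ^ 2)⁻¹) := by field_simp
        _ ≤ _ := by gcongr
    calc ∑ i, (‖ρ i - 1‖ ^ 2)⁻¹ ≤ ∑ i, (1 + 1 / c) ^ 2 * l * (1 / (s - ρ i)).re :=
          Finset.sum_le_sum fun i _ => h5 i
      _ = (1 + 1 / c) ^ 2 * l * ∑ i, (1 / (s - ρ i)).re := by rw [Finset.mul_sum]
      _ ≤ (1 + 1 / c) ^ 2 * l * ((C₀ + 4000) * l) := by gcongr
      _ = _ := by ring
  · intro z hz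
    refine (hEb z hz).trans ?_
    nlinarith
  · intro z hz hz1
    exact hE z hz (DirichletCharacter.LFunction_ne_zero_of_one_le_re χ (Or.inl hχ) hz1.le)

/-! ### Laplace transforms of smooth compactly supported functions. -/

/-- The two-sided Laplace transform of `g`. -/
noncomputable def laplaceTransform (g : ℝ → ℂ) (z : ℂ) : ℂ := ∫ v : ℝ, g v * Complex.exp (z * v)

section laplace

open scoped FourierTransform
open Complex MeasureTheory Set Filter Topology

theorem integrable_mul_exp_of_hasCompactSupport {g : ℝ → ℂ} (hg : Continuous g)
    (hs : HasCompactSupport g) (z : ℂ) : Integrable fun v : ℝ => g v * exp (z * v) :=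
  (hg.mul (by fun_prop)).integrable_of_hasCompactSupport hs.mul_right

theorem HasCompactSupport.iteratedDeriv_real {g : ℝ → ℂ} (hs : HasCompactSupport g) (j : ℕ) :
    HasCompactSupport (iteratedDeriv j g) := by
  induction j with
  | zero => simpa using hs
  | succ j ih => rw [iteratedDeriv_succ]; exact ih.deriv

theorem laplaceTransform_deriv {g : ℝ → ℂ} (hg : ContDiff ℝ 1 g) (hs : HasCompactSupport g)
    (z : ℂ) : laplaceTransform (deriv g) z = -z * laplaceTransform g z := by
  have hd : Differentiable ℝ g := hg.differentiable one_ne_zero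
  have hexp : ∀ v : ℝ, HasDerivAt (fun v : ℝ => exp (z * v)) (z * exp (z * v)) v := by
    intro v
    have h1 : HasDerivAt (fun v : ℝ => z * (v : ℂ)) z v := by
      simpa using (hasDerivAt_id (v : ℂ)).comp_ofReal.const_mul z
    exact h1.cexp.congr_deriv (mul_comm _ _)
  have h := integral_mul_deriv_eq_deriv_mul_of_integrable (u := g)
    (v := fun v : ℝ => exp (z * v)) (u' := deriv g) (v' := fun v => z * exp (z * v))
    (fun v _ => (hd v).hasDerivAt) (fun v _ => hexp v)
    ((hg.continuous.mul (by fun_prop)).integrable_of_hasCompactSupport hs.mul_right)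
    (integrable_mul_exp_of_hasCompactSupport hg.continuous_deriv_one hs.deriv z)
    (integrable_mul_exp_of_hasCompactSupport hg.continuous hs z)
  have h2 : ∫ v : ℝ, g v * (z * exp (z * v)) = z * laplaceTransform g z := by
    rw [laplaceTransform, ← integral_const_mul]
    congr 1; ext v; ring
  rw [h2] at h
  rw [laplaceTransform, neg_mul, h, neg_neg]

theorem laplaceTransform_iteratedDeriv {g : ℝ → ℂ} (hg : ContDiff ℝ ∞ g)
    (hs : HasCompactSupport g) (z : ℂ) (j : ℕ) :
    laplaceTransform (iteratedDeriv j g) z = (-z) ^ j * laplaceTransform g z := by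
  induction j with
  | zero => simp
  | succ j ih =>
    rw [iteratedDeriv_succ, laplaceTransform_deriv ?_ (hs.iteratedDeriv_real j), ih]
    · ring
    · rw [iteratedDeriv_eq_iterate]
      exact ContDiff.iterate_deriv' 1 j (hg.of_le (by exact_mod_cast le_top))

theorem norm_laplaceTransform_le_mul_integral {g : ℝ → ℂ} {a b X : ℝ} {m : ℝ → ℝ} {z : ℂ}
    (hs : Function.support g ⊆ Icc a b) (hm : IntegrableOn m (Icc a b))
    (hg : ∀ v ∈ Icc a b, ‖g v‖ ≤ m v) (hX : ∀ v ∈ Icc a b, Real.exp (z.re * v) ≤ X) :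
    ‖laplaceTransform g z‖ ≤ X * ∫ v in Icc a b, m v := by
  rw [← integral_const_mul, laplaceTransform]
  have h1 : ∫ v : ℝ, g v * exp (z * v) = ∫ v in Icc a b, g v * exp (z * v) := by
    refine (setIntegral_eq_integral_of_forall_compl_eq_zero fun v hv => ?_).symm
    have : g v = 0 := by
      by_contra h
      exact hv (hs h)
    rw [this, zero_mul]
  rw [h1]
  refine norm_integral_le_of_norm_le (hm.const_mul X) ?_
  refine (ae_restrict_iff' measurableSet_Icc).2 (Eventually.of_forall fun v hv => ?_)
  rw [norm_mul, Complex.norm_exp, mul_comm]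
  have : (z * v).re = z.re * v := by simp
  rw [this]
  have h3 := hX v hv
  have h4 := hg v hv
  have h5 := (Real.exp_pos (z.re * v)).le
  exact mul_le_mul h3 h4 (norm_nonneg _) (h5.trans h3)

theorem norm_laplaceTransform_le {g : ℝ → ℂ} {a b X S : ℝ} {z : ℂ} (hab : a ≤ b)
    (hs : Function.support g ⊆ Icc a b)
    (hg : ∀ v ∈ Icc a b, ‖g v‖ ≤ S) (hX : ∀ v ∈ Icc a b, Real.exp (z.re * v) ≤ X) :
    ‖laplaceTransform g z‖ ≤ X * (S * (b - a)) := by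
  refine (norm_laplaceTransform_le_mul_integral (m := fun _ => S) hs ?_ hg hX).trans (le_of_eq ?_)
  · exact integrableOn_const (by simp)
  · rw [setIntegral_const]
    simp [hab, mul_comm]

/-- Integrating the weight $v^{-3}$ from $a$ on gives $a^{-2}$ with no dependence on $b$. This keeps
$b/a$, eventually $\alpha_2/\alpha_1$, out of the contribution of the zeros. -/
theorem norm_laplaceTransform_le_of_cube {g : ℝ → ℂ} {a b X M : ℝ} {z : ℂ} (ha : 0 < a)
    (hX0 : 0 ≤ X) (hM : 0 ≤ M) (hs : Function.support g ⊆ Icc a b)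
    (hg : ∀ v ∈ Icc a b, ‖g v‖ ≤ M / v ^ 3) (hX : ∀ v ∈ Icc a b, Real.exp (z.re * v) ≤ X) :
    ‖laplaceTransform g z‖ ≤ X * (M / a ^ 2) := by
  have hI : IntegrableOn (fun v : ℝ => M * v ^ (-3 : ℝ)) (Ioi a) :=
    (integrableOn_Ioi_rpow_of_lt (by norm_num) ha).const_mul M
  have hI' : IntegrableOn (fun v : ℝ => M * v ^ (-3 : ℝ)) (Ici a) :=
    (integrableOn_Ici_iff_integrableOn_Ioi).2 hI
  refine (norm_laplaceTransform_le_mul_integral (m := fun v => M * v ^ (-3 : ℝ)) hs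
    (hI'.mono_set Icc_subset_Ici_self) (fun v hv => (hg v hv).trans (le_of_eq ?_)) hX).trans ?_
  · have : v ^ (-3 : ℝ) = (v ^ 3)⁻¹ := by
      rw [Real.rpow_neg (ha.le.trans hv.1)]; norm_num
    rw [this, div_eq_mul_inv]
  · refine mul_le_mul_of_nonneg_left ?_ hX0
    have h1 : ∫ v in Icc a b, M * v ^ (-3 : ℝ) ≤ ∫ v in Ici a, M * v ^ (-3 : ℝ) := by
      refine setIntegral_mono_set hI' ?_ (Eventually.of_forall Icc_subset_Ici_self)
      refine (ae_restrict_iff' measurableSet_Ici).2 (Eventually.of_forall fun v hv => ?_)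
      exact mul_nonneg hM (Real.rpow_nonneg (ha.le.trans hv) _)
    refine h1.trans ?_
    rw [integral_Ici_eq_integral_Ioi, integral_const_mul,
      integral_Ioi_rpow_of_lt (by norm_num) ha]
    have h2 : a ^ (-3 + 1 : ℝ) = (a ^ 2)⁻¹ := by
      rw [show (-3 + 1 : ℝ) = -2 by norm_num, Real.rpow_neg ha.le]; norm_num
    rw [h2, div_eq_mul_inv M]
    refine mul_le_mul_of_nonneg_left ?_ hM
    have : 0 < (a ^ 2)⁻¹ := by positivity
    rw [show (-3 + 1 : ℝ) = -2 by norm_num, neg_div_neg_eq]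
    linarith

theorem differentiable_laplaceTransform {g : ℝ → ℂ} (hg : Continuous g)
    (hs : HasCompactSupport g) : Differentiable ℂ (laplaceTransform g) := by
  intro z₀
  set bound : ℝ → ℝ := fun v => ‖g v‖ * (|v| * Real.exp ((‖z₀‖ + 1) * |v|)) with hb
  have h := hasDerivAt_integral_of_dominated_loc_of_deriv_le (μ := volume)
    (F := fun z (v : ℝ) => g v * exp (z * v)) (F' := fun z (v : ℝ) => g v * (v * exp (z * v)))
    (x₀ := z₀) (s := Metric.ball z₀ 1) (bound := bound) (Metric.ball_mem_nhds z₀ one_pos)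
    (Eventually.of_forall fun z => (integrable_mul_exp_of_hasCompactSupport hg hs z).1)
    (integrable_mul_exp_of_hasCompactSupport hg hs z₀)
    (Continuous.aestronglyMeasurable (by fun_prop)) ?_ ?_ ?_
  · exact h.2.differentiableAt
  · refine Eventually.of_forall fun v z hz => ?_
    rw [hb, norm_mul, norm_mul, Complex.norm_real, Real.norm_eq_abs, Complex.norm_exp]
    refine mul_le_mul_of_nonneg_left (mul_le_mul_of_nonneg_left (Real.exp_le_exp.2 ?_)
      (abs_nonneg v)) (norm_nonneg _)
    have h1 : ‖z‖ ≤ ‖z₀‖ + 1 := by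
      have h2 : ‖z - z₀‖ < 1 := by simpa [dist_eq_norm] using hz
      have := norm_le_norm_add_norm_sub' z z₀
      linarith
    calc (z * v).re ≤ ‖z * v‖ := re_le_norm _
      _ = ‖z‖ * |v| := by rw [norm_mul, Complex.norm_real, Real.norm_eq_abs]
      _ ≤ _ := by gcongr
  · refine Continuous.integrable_of_hasCompactSupport (by fun_prop) ?_
    exact hs.norm.mul_right
  · refine Eventually.of_forall fun v z _ => ?_
    have h1 : HasDerivAt (fun z : ℂ => z * (v : ℂ)) v z := by
      simpa using (hasDerivAt_id z).mul_const (v : ℂ)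
    exact (h1.cexp.const_mul (g v)).congr_deriv (by ring)

/-- The Laplace transform of a smooth compactly supported function decays rapidly on vertical
lines. -/
theorem integrable_laplaceTransform_vertical {g : ℝ → ℂ} (hg : ContDiff ℝ ∞ g)
    (hs : HasCompactSupport g) (η : ℝ) :
    Integrable fun t : ℝ => laplaceTransform g (η + t * I) := by
  have hc : Continuous fun t : ℝ => laplaceTransform g (η + t * I) :=
    (differentiable_laplaceTransform hg.continuous hs).continuous.comp (by fun_prop)
  have hb : ∀ (h : ℝ → ℂ), ∀ t : ℝ, ‖laplaceTransform h (η + t * I)‖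
      ≤ ∫ v : ℝ, ‖h v * exp (η * v)‖ := by
    intro h t
    refine (norm_integral_le_integral_norm _).trans (le_of_eq ?_)
    congr 1; ext v
    rw [norm_mul, norm_mul, Complex.norm_exp, Complex.norm_exp]
    simp
  set K₀ := ∫ v : ℝ, ‖g v * exp (η * v)‖ with hK₀
  set K₂ := ∫ v : ℝ, ‖iteratedDeriv 2 g v * exp (η * v)‖ with hK₂
  refine (integrable_inv_one_add_sq.const_mul (K₀ + K₂)).mono' hc.aestronglyMeasurable
    (Eventually.of_forall fun t => ?_)
  rw [← div_eq_mul_inv, le_div_iff₀ (by positivity)]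
  have h2 := hb (iteratedDeriv 2 g) t
  rw [laplaceTransform_iteratedDeriv hg hs, norm_mul, norm_pow, norm_neg, ← hK₂] at h2
  have h0 := hb g t
  have h3 : t ^ 2 ≤ ‖(η + t * I : ℂ)‖ ^ 2 := by
    rw [← normSq_eq_norm_sq, normSq_apply]
    simp
    nlinarith [sq_nonneg η]
  have h4 := norm_nonneg (laplaceTransform g (η + t * I))
  nlinarith

/-- Laplace inversion for smooth compactly supported functions. -/
theorem laplaceTransform_inversion {g : ℝ → ℂ} (hg : ContDiff ℝ ∞ g)
    (hs : HasCompactSupport g) (η v : ℝ) :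
    g v = (2 * Real.pi : ℂ)⁻¹ *
      ∫ t : ℝ, laplaceTransform g (η + t * I) * exp (-(η + t * I) * v) := by
  -- Twisting by $e^{\eta v}$ turns the line $\Re z=\eta$ into the Fourier axis, with $t=-2\pi\xi$.
  set h : ℝ → ℂ := fun v => g v * exp (η * v) with hh
  have hhc : Continuous h := hg.continuous.mul (by fun_prop)
  have hhi : Integrable h := integrable_mul_exp_of_hasCompactSupport hg.continuous hs η
  have hF : ∀ ξ : ℝ, 𝓕 h ξ = laplaceTransform g (η + ((-2 * Real.pi * ξ : ℝ) : ℂ) * I) := by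
    intro ξ
    rw [Real.fourier_eq', laplaceTransform]
    congr 1; ext v
    rw [smul_eq_mul, hh, ← mul_assoc, mul_comm (exp _) (g v), mul_assoc, ← exp_add]
    congr 2
    simp
    ring
  have hpi : (-2 * Real.pi) ≠ 0 := by have := Real.pi_pos; linarith
  have hFi : Integrable (𝓕 h) := by
    have h1 := (integrable_laplaceTransform_vertical hg hs η).comp_mul_left' hpi
    refine h1.congr (Eventually.of_forall fun ξ => ?_)
    exact (hF ξ).symm
  have hinv := congrFun (hhc.fourierInv_fourier_eq hhi hFi) v
  rw [Real.fourierInv_eq'] at hinv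
  have h2 : ∫ ξ : ℝ, exp (↑(2 * Real.pi * inner ℝ ξ v) * I) • 𝓕 h ξ
      = (2 * Real.pi : ℂ)⁻¹ * ∫ t : ℝ, laplaceTransform g (η + t * I) * exp (-(t * I) * v) := by
    have h3 := Measure.integral_comp_mul_left
      (fun t : ℝ => laplaceTransform g (η + t * I) * exp (-(t * I) * v)) (-2 * Real.pi)
    have h4 : |(-2 * Real.pi)⁻¹| = (2 * Real.pi)⁻¹ := by
      rw [abs_inv, abs_of_neg (by have := Real.pi_pos; linarith)]; ring
    rw [h4, Complex.real_smul] at h3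
    push_cast at h3
    rw [← h3]
    congr 1; ext ξ
    rw [hF, smul_eq_mul, mul_comm]
    push_cast
    congr 2
    simp
    ring
  rw [h2] at hinv
  have h5 : g v = h v * exp (-(η * v)) := by
    rw [hh, mul_assoc, ← exp_add]; simp
  rw [h5, ← hinv, mul_assoc, ← integral_mul_const]
  congr 2; ext t
  rw [mul_assoc, ← exp_add]
  congr 2
  ring

/-- The pairing of the Laplace transform with the Cauchy kernel `1 / (1 + η + it - ρ)`. -/
theorem laplaceTransform_eq_integral_cauchy {g : ℝ → ℂ} (hg : ContDiff ℝ ∞ g) {a b : ℝ}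
    (ha : 0 < a) (hs : Function.support g ⊆ Icc a b) {η : ℝ} {ρ : ℂ} (hρ : ρ.re < 1 + η) :
    laplaceTransform g (ρ - 1) = (2 * Real.pi : ℂ)⁻¹ *
      ∫ t : ℝ, laplaceTransform g (η + t * I) * (1 / (1 + (η + t * I) - ρ)) := by
  have hcs : HasCompactSupport g := HasCompactSupport.of_support_subset_isCompact isCompact_Icc hs
  have hΦ := integrable_laplaceTransform_vertical hg hcs η
  -- The support lies in $v>0$. Inserting the inversion formula and swapping integrals leaves
  -- $\int_0^\infty e^{-(1+\eta+it-\rho)v}\,dv$, which converges because $\Re\rho<1+\eta$ and equals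
  -- the Cauchy kernel.
  have h1 : laplaceTransform g (ρ - 1) = ∫ v in Ioi (0 : ℝ), g v * exp ((ρ - 1) * v) := by
    rw [laplaceTransform]
    refine (setIntegral_eq_integral_of_forall_compl_eq_zero fun v hv => ?_).symm
    have : g v = 0 := by
      by_contra h
      exact hv (ha.trans_le (hs h).1)
    rw [this, zero_mul]
  have h2 : ∀ v : ℝ, g v * exp ((ρ - 1) * v) = (2 * Real.pi : ℂ)⁻¹ *
      ∫ t : ℝ, laplaceTransform g (η + t * I) * exp (-(1 + (η + t * I) - ρ) * v) := by
    intro v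
    rw [laplaceTransform_inversion hg hcs η v, mul_assoc, ← integral_mul_const]
    congr 2; ext t
    rw [mul_assoc, ← exp_add]
    congr 2
    ring
  rw [h1]
  simp_rw [h2]
  rw [integral_const_mul, integral_integral_swap]
  · congr 2; ext t
    rw [integral_const_mul, integral_exp_mul_complex_Ioi]
    · have : (1 + (η + t * I) - ρ) ≠ 0 := by
        intro h
        have := congrArg re h
        simp at this
        linarith
      rw [ofReal_zero, mul_zero, exp_zero, neg_div_neg_eq]
    · simp
      linarith
  · have hprod : Integrable (fun p : ℝ × ℝ => Real.exp (-(1 + η - ρ.re) * p.1) *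
        ‖laplaceTransform g (η + p.2 * I)‖) ((volume.restrict (Ioi 0)).prod volume) :=
      Integrable.mul_prod (f := fun v : ℝ => Real.exp (-(1 + η - ρ.re) * v))
        (integrableOn_exp_mul_Ioi (by linarith) 0) hΦ.norm
    refine hprod.mono' ?_ (Eventually.of_forall fun p => ?_)
    · have hc : Continuous fun t : ℝ => laplaceTransform g (η + t * I) :=
        (differentiable_laplaceTransform hg.continuous hcs).continuous.comp (by fun_prop)
      refine Continuous.aestronglyMeasurable ?_
      exact (hc.comp continuous_snd).mul (by fun_prop)
    · simp only [Function.uncurry]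
      rw [norm_mul, Complex.norm_exp, mul_comm]
      refine le_of_eq ?_
      congr 2
      simp

end laplace

/-! ### The contour integral for twisted von Mangoldt sums. -/

section explicitFormula

open Complex MeasureTheory Set Filter Topology ArithmeticFunction

/-- Apply inversion at $v=\log n$, so that $e^{-zv}/n=n^{-1-z}$, and sum under the integral.
Absolute convergence at $1+\eta$, the same at every height $t$, justifies the interchange. -/
theorem tsum_twist_vonMangoldt_eq_integral {N : ℕ} [NeZero N] (χ : DirichletCharacter ℂ N)
    {g : ℝ → ℂ} (hg : ContDiff ℝ ∞ g) (hs : HasCompactSupport g) {η : ℝ} (hη : 0 < η) :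
    ∑' n : ℕ, χ (n : ZMod N) * (vonMangoldt n : ℂ) / n * g (Real.log n) =
      -((2 * Real.pi : ℂ)⁻¹ * ∫ t : ℝ, laplaceTransform g (η + t * I) *
        logDeriv (DirichletCharacter.LFunction χ) (1 + (η + t * I))) := by
  set α : ℕ → ℂ := fun n => χ (n : ZMod N) * (vonMangoldt n : ℂ) with hα
  have hre : ∀ t : ℝ, (1 + (η + t * I) : ℂ).re = 1 + η := by intro t; simp
  have hΦ := integrable_laplaceTransform_vertical hg hs η
  have hsum : Summable fun n => ‖LSeries.term α (1 + η : ℂ) n‖ :=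
    (DirichletCharacter.LSeriesSummable_twist_vonMangoldt χ (s := 1 + η)
      (by simpa using hη)).norm
  have hnorm : ∀ (t : ℝ) (n : ℕ),
      ‖LSeries.term α (1 + (η + t * I)) n‖ = ‖LSeries.term α (1 + η : ℂ) n‖ := by
    intro t n
    rw [LSeries.norm_term_eq, LSeries.norm_term_eq, hre]
    simp
  have hcont : ∀ n : ℕ, Continuous fun t : ℝ => LSeries.term α (1 + (η + t * I)) n := by
    intro n
    rcases eq_or_ne n 0 with rfl | hn
    · simpa using continuous_const
    · simp_rw [LSeries.term_of_ne_zero hn]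
      refine Continuous.div continuous_const ?_ ?_
      · refine Continuous.const_cpow (by fun_prop) (Or.inl (by exact_mod_cast hn))
      · intro t
        simp [hn]
  have hterm : ∀ n : ℕ, α n / n * g (Real.log n) = (2 * Real.pi : ℂ)⁻¹ *
      ∫ t : ℝ, laplaceTransform g (η + t * I) * LSeries.term α (1 + (η + t * I)) n := by
    intro n
    rcases eq_or_ne n 0 with rfl | hn
    · simp
    · rw [laplaceTransform_inversion hg hs η (Real.log n), mul_left_comm, ← integral_const_mul]
      congr 2; ext t
      rw [LSeries.term_of_ne_zero hn, cpow_def_of_ne_zero (by exact_mod_cast hn), mul_add, mul_one,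
        exp_add, exp_log (by exact_mod_cast hn), natCast_log, neg_mul, exp_neg]
      rw [mul_comm (Complex.log n)]
      field_simp
  have hF := hasSum_integral_of_summable_integral_norm (μ := volume)
    (F := fun (n : ℕ) (t : ℝ) => laplaceTransform g (η + t * I) *
      LSeries.term α (1 + (η + t * I)) n) ?_ ?_
  · simp_rw [hα] at hterm
    simp_rw [hterm]
    rw [tsum_mul_left, hF.tsum_eq, ← mul_neg, ← integral_neg]
    congr 2; ext t
    rw [tsum_mul_left, DirichletCharacter.logDeriv_LFunction_eq χ (by rw [hre]; linarith), mul_neg,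
      neg_neg]
    rfl
  · intro n
    refine hΦ.mul_bdd (c := ‖LSeries.term α (1 + η : ℂ) n‖) (hcont n).aestronglyMeasurable
      (Eventually.of_forall fun t => (hnorm t n).le)
  · simp_rw [norm_mul, hnorm, integral_mul_const]
    exact hsum.mul_left _

/-- Cauchy's theorem on a rectangle trades the segment at abscissa $\eta$ for one at $-\delta$, at
the cost of two horizontal sides. -/
theorem norm_integral_vertical_le {F : ℂ → ℂ} {η δ A H : ℝ} (hη : 0 < η) (hδ : 0 < δ)
    (hF : DifferentiableOn ℂ F (uIcc (-δ) η ×ℂ uIcc (-δ) δ))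
    (hA : ∀ y ∈ Icc (-δ) δ, ‖F (-δ + y * I)‖ ≤ A)
    (hH : ∀ x ∈ Icc (-δ) η, ‖F (x + δ * I)‖ ≤ H ∧ ‖F (x - δ * I)‖ ≤ H) :
    ‖∫ y in (-δ)..δ, F (η + y * I)‖ ≤ 2 * δ * A + 2 * (η + δ) * H := by
  have h := integral_boundary_rect_eq_zero_of_differentiableOn F ⟨-δ, -δ⟩ ⟨η, δ⟩ hF
  simp only [smul_eq_mul] at h
  have e : I * ∫ y in (-δ)..δ, F (η + y * I) = I * (∫ y in (-δ)..δ, F (((-δ : ℝ) : ℂ) + y * I))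
      - (∫ x in (-δ)..η, F (x + ((-δ : ℝ) : ℂ) * I)) + ∫ x in (-δ)..η, F (x + δ * I) := by
    linear_combination h
  have n1 : ‖∫ y in (-δ)..δ, F (((-δ : ℝ) : ℂ) + y * I)‖ ≤ A * |δ - -δ| := by
    refine intervalIntegral.norm_integral_le_of_norm_le_const fun y hy => ?_
    rw [uIoc_of_le (by linarith)] at hy
    simpa using hA y ⟨hy.1.le, hy.2⟩
  have n2 : ‖∫ x in (-δ)..η, F (x + ((-δ : ℝ) : ℂ) * I)‖ ≤ H * |η - -δ| := by
    refine intervalIntegral.norm_integral_le_of_norm_le_const fun x hx => ?_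
    rw [uIoc_of_le (by linarith)] at hx
    simpa [sub_eq_add_neg] using (hH x ⟨hx.1.le, hx.2⟩).2
  have n3 : ‖∫ x in (-δ)..η, F (x + δ * I)‖ ≤ H * |η - -δ| := by
    refine intervalIntegral.norm_integral_le_of_norm_le_const fun x hx => ?_
    rw [uIoc_of_le (by linarith)] at hx
    exact (hH x ⟨hx.1.le, hx.2⟩).1
  rw [abs_of_nonneg (by linarith)] at n1 n2 n3
  have : ‖∫ y in (-δ)..δ, F (η + y * I)‖ = ‖I * ∫ y in (-δ)..δ, F (η + y * I)‖ := by simp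
  rw [this, e]
  refine (norm_add_le _ _).trans ?_
  refine (add_le_add_left (norm_sub_le _ _) _).trans ?_
  rw [norm_mul, norm_I, one_mul]
  linarith

/-- Splitting a vertical integral at height `δ`. -/
theorem norm_integral_le_of_split {Ψ : ℝ → ℂ} (hΨ : Integrable Ψ) {δ X K : ℝ} (hδ : 0 < δ)
    (hK : 0 ≤ K)
    (hmid : ‖∫ y in (-δ)..δ, Ψ y‖ ≤ X) (htail : ∀ t, δ < |t| → ‖Ψ t‖ ≤ K / |t| ^ 2) :
    ‖∫ t, Ψ t‖ ≤ X + K * (1 + 1 / δ ^ 2) * Real.pi := by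
  rw [← integral_add_compl (measurableSet_Ioc (a := -δ) (b := δ)) hΨ]
  refine (norm_add_le _ _).trans (add_le_add ?_ ?_)
  · rwa [← intervalIntegral.integral_of_le (by linarith)]
  · have hI := integrable_inv_one_add_sq.const_mul (K * (1 + 1 / δ ^ 2))
    have h1 : ‖∫ t in (Ioc (-δ) δ)ᶜ, Ψ t‖
        ≤ ∫ t in (Ioc (-δ) δ)ᶜ, K * (1 + 1 / δ ^ 2) * (1 + t ^ 2)⁻¹ := by
      refine norm_integral_le_of_norm_le hI.integrableOn ?_
      -- The half-open interval leaves $-\delta$ in the complement, where the strict tail condition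
      -- fails; a null set is discarded.
      have hne : ∀ᵐ t : ℝ ∂(volume.restrict (Ioc (-δ) δ)ᶜ), t ≠ -δ :=
        ae_restrict_of_ae (by simp [ae_iff, measure_singleton])
      filter_upwards [hne, ae_restrict_mem measurableSet_Ioc.compl] with t ht1 ht2
      have ht : δ < |t| := by
        rw [lt_abs]
        simp only [mem_compl_iff, mem_Ioc, not_and_or, not_lt, not_le] at ht2
        rcases ht2 with h | h
        · right
          have := lt_of_le_of_ne h ht1
          linarith
        · exact Or.inl h
      refine (htail t ht).trans ?_
      have ht2 : δ ^ 2 ≤ t ^ 2 := by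
        rw [← sq_abs t]; exact pow_le_pow_left₀ hδ.le ht.le 2
      have ht0 : 0 < t ^ 2 := lt_of_lt_of_le (by positivity) ht2
      rw [sq_abs, ← div_eq_mul_inv, mul_div_assoc, div_eq_mul_inv]
      refine mul_le_mul_of_nonneg_left ?_ hK
      rw [le_div_iff₀ (by positivity), inv_mul_le_iff₀ ht0]
      have : 1 ≤ t ^ 2 * (1 / δ ^ 2) := by
        rw [mul_one_div, le_div_iff₀ (by positivity)]; linarith
      nlinarith
    refine h1.trans ?_
    rw [← integral_univ_inv_one_add_sq, ← integral_const_mul]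
    refine setIntegral_le_integral hI (Eventually.of_forall fun t => ?_)
    have : 0 < δ ^ 2 := by positivity
    positivity

end explicitFormula

/-! ### Estimating the zeros and the remainder. -/

section explicitFormulaBound

open Complex MeasureTheory Set Filter Topology ArithmeticFunction

theorem support_iteratedDeriv_subset_of_isClosed {g : ℝ → ℂ} {s : Set ℝ} (hs : IsClosed s)
    (hg : Function.support g ⊆ s) (j : ℕ) : Function.support (iteratedDeriv j g) ⊆ s := by
  induction j with
  | zero => simpa using hg
  | succ j ih =>
    rw [iteratedDeriv_succ]
    exact (support_deriv_subset).trans (closure_minimal ih hs)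

/-- The contribution of the zeros `ρ` to the explicit formula. -/
theorem norm_laplaceTransform_zero_le {g : ℝ → ℂ} (hg : ContDiff ℝ ∞ g) {a b M κ : ℝ}
    (ha : 0 < a) (hM : 0 ≤ M) (hs : Function.support g ⊆ Icc a b)
    (hgM : ∀ v ∈ Icc a b, ‖iteratedDeriv 2 g v‖ ≤ M / v ^ 3) {ρ : ℂ} (hκ : 0 < κ)
    (hρ : ρ.re ≤ 1 - κ) :
    ‖laplaceTransform g (ρ - 1)‖ ≤ (‖ρ - 1‖ ^ 2)⁻¹ * (Real.exp (-(κ * a)) * (M / a ^ 2)) := by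
  have hcs : HasCompactSupport g := HasCompactSupport.of_support_subset_isCompact isCompact_Icc hs
  -- Two integrations by parts produce $(\rho-1)^{-2}$, and $v\ge a$ on the support produces the
  -- saving $e^{-\kappa a}$.
  have h1 := norm_laplaceTransform_le_of_cube (z := ρ - 1) (X := Real.exp (-(κ * a))) ha
    (Real.exp_pos _).le hM (support_iteratedDeriv_subset_of_isClosed isClosed_Icc hs 2) hgM (by
      intro v hv
      apply Real.exp_le_exp.2
      simp only [sub_re, one_re]
      have h2 : 0 ≤ v := ha.le.trans hv.1
      nlinarith [hv.1])
  rw [laplaceTransform_iteratedDeriv hg hcs, norm_mul, norm_pow, norm_neg] at h1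
  have h0 : 0 < ‖ρ - 1‖ := by
    rw [norm_pos_iff]
    intro h
    have := congrArg re h
    simp at this
    linarith
  rwa [← div_eq_inv_mul, le_div_iff₀ (by positivity), mul_comm]

/-- Three integrations by parts; the condition on $\Re z$ keeps $|e^{zv}|\le e<3$ on the support. -/
theorem norm_laplaceTransform_le_cube {g : ℝ → ℂ} (hg : ContDiff ℝ ∞ g) {a b B : ℝ}
    (ha : 0 < a) (hab : a ≤ b) (hB : 0 ≤ B) (hs : Function.support g ⊆ Icc a b)
    (hgB : ∀ v ∈ Icc a b, ‖iteratedDeriv 3 g v‖ ≤ B / v ^ 4) {z : ℂ} (hz : z.re ≤ 1 / b) :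
    ‖z‖ ^ 3 * ‖laplaceTransform g z‖ ≤ 3 * (B * b / a ^ 4) := by
  have hcs : HasCompactSupport g := HasCompactSupport.of_support_subset_isCompact isCompact_Icc hs
  have hb : 0 < b := ha.trans_le hab
  have h1 := norm_laplaceTransform_le (z := z) (X := 3) (S := B / a ^ 4) hab
    (support_iteratedDeriv_subset_of_isClosed isClosed_Icc hs 3)
    (fun v hv => (hgB v hv).trans (by have := hv.1; gcongr)) (by
      intro v hv
      have h2 : z.re * v ≤ 1 := by
        have h3 : 0 ≤ v := ha.le.trans hv.1
        calc z.re * v ≤ 1 / b * v := by gcongr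
          _ ≤ 1 / b * b := by have := hv.2; gcongr
          _ = 1 := by field_simp
      have := Real.exp_one_lt_d9
      linarith [Real.exp_le_exp.2 h2])
  rw [laplaceTransform_iteratedDeriv hg hcs, norm_mul, norm_pow, norm_neg] at h1
  refine h1.trans ?_
  have h4 : B / a ^ 4 * (b - a) ≤ B * b / a ^ 4 := by
    rw [div_mul_eq_mul_div]
    gcongr
    linarith
  linarith

set_option maxHeartbeats 1000000 in
/-- Smooth sums of `χ(n) Λ(n) / n` under the zero-free region hypothesis. -/
theorem exists_norm_tsum_twist_vonMangoldt_le {c : ℝ} (hc : 0 < c) : ∃ C : ℝ, 1 ≤ C ∧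
    ∀ {D : ℕ} [NeZero D], 3 < D → ∀ χ : DirichletCharacter ℂ D, χ ≠ 1 →
      HypothesisH (DirichletCharacter.LFunction χ) D c →
      ∀ {g : ℝ → ℂ} {a b M B : ℝ}, ContDiff ℝ ∞ g → 0 < a → a ≤ b → 16 ≤ b → 0 ≤ M → 0 ≤ B →
        Function.support g ⊆ Icc a b →
        (∀ v ∈ Icc a b, ‖iteratedDeriv 2 g v‖ ≤ M / v ^ 3) →
        (∀ v ∈ Icc a b, ‖iteratedDeriv 3 g v‖ ≤ B / v ^ 4) →
        (∀ v ∈ Icc a b, ‖g v‖ ≤ B / v) →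
        ‖∑' n : ℕ, χ (n : ZMod D) * (vonMangoldt n : ℂ) / n * g (Real.log n)‖ ≤
          C * (M * (Real.log D / a) ^ 2 * Real.exp (-(c / Real.log D * a)) +
            B * (Real.log D * b ^ 2 / a ^ 4 + Real.log D * Real.exp (-(a / 16)) * b / a)) := by
  obtain ⟨C₀, hC₀, hlog⟩ := exists_norm_logDeriv_LFunction_le
  obtain ⟨C₁, hC₁, hPF⟩ := exists_LFunction_partial_fractions hc
  refine ⟨100000 * (C₀ + C₁), by linarith, ?_⟩
  intro D _ hD χ hχ hH g a b M B hg ha hab hb hM hB hs hgM hgB hgB0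
  obtain ⟨N, ρ, E, hN, hρ, hρsum, hEd, hEb, hE⟩ := hPF hD χ hχ hH
  have hcs : HasCompactSupport g := HasCompactSupport.of_support_subset_isCompact isCompact_Icc hs
  have hDr : (4 : ℝ) ≤ D := by exact_mod_cast hD
  set l := Real.log D with hl
  have hl1 : 1 ≤ l := by
    rw [hl, Real.le_log_iff_exp_le (by linarith)]
    have := Real.exp_one_lt_d9
    linarith
  have hl0 : 0 < l := by linarith
  have hb0 : 0 < b := by linarith
  -- This abscissa keeps the exponential bounded on the support, while $L'/L$ and the kernels
  -- $1/(s-\rho)$ are only $O(b)$ on the line. The condition $16\le b$ keeps the later rectangle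
  -- inside the disc where $E$ is controlled.
  set η : ℝ := 1 / b with hη
  have hη0 : 0 < η := by positivity
  have hη1 : η ≤ 1 / 16 := by rw [hη]; gcongr
  set Φ : ℝ → ℂ := fun t => laplaceTransform g (η + t * I) with hΦ
  have hΦi : Integrable Φ := integrable_laplaceTransform_vertical hg hcs η
  set LD : ℝ → ℂ := fun t => logDeriv (DirichletCharacter.LFunction χ) (1 + (η + t * I)) with hLD
  have hre : ∀ t : ℝ, (1 + (η + t * I) : ℂ).re = 1 + η := by intro t; simp
  have hLDb : ∀ t, ‖LD t‖ ≤ C₀ * b := by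
    intro t
    have := hlog χ (1 + (η + t * I)) (by rw [hre]; linarith) (by rw [hre]; linarith)
    rw [hre] at this
    have h2 : C₀ / (1 + η - 1) = C₀ * b := by rw [hη]; field_simp; ring
    rwa [h2] at this
  have hLDc : Continuous LD := by
    have h1 : ContinuousOn (logDeriv (DirichletCharacter.LFunction χ)) {s : ℂ | 1 < s.re} := by
      have hd := DirichletCharacter.differentiable_LFunction hχ
      exact (hd.contDiff.continuous_deriv le_rfl).continuousOn.div hd.continuous.continuousOn
        fun s hs => DirichletCharacter.LFunction_ne_zero_of_one_le_re χ (Or.inl hχ) (le_of_lt hs)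
    exact h1.comp_continuous (by fun_prop) fun t => by
      simp only [mem_ofPred_eq, hre]; linarith
  have hΦLD : Integrable fun t => Φ t * LD t :=
    hΦi.mul_bdd hLDc.aestronglyMeasurable (Eventually.of_forall hLDb)
  have hρ1 : ∀ i, (ρ i).re ≤ 1 := fun i => by
    have : 0 < c / l := by positivity
    linarith [hρ i]
  have hden : ∀ i, ∀ t : ℝ, η ≤ ‖(1 + (η + t * I) - ρ i : ℂ)‖ := by
    intro i t
    refine le_trans ?_ (re_le_norm _)
    rw [sub_re, hre]
    linarith [hρ1 i]
  have hKb : ∀ i, ∀ t : ℝ, ‖(1 / (1 + (η + t * I) - ρ i) : ℂ)‖ ≤ b := by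
    intro i t
    rw [norm_div, norm_one, div_le_iff₀ (hη0.trans_le (hden i t))]
    calc (1 : ℝ) = b * η := by rw [hη]; field_simp
      _ ≤ _ := by gcongr; exact hden i t
  have hΦK : ∀ i, Integrable fun t : ℝ => Φ t * (1 / (1 + (η + t * I) - ρ i)) := by
    intro i
    refine hΦi.mul_bdd (Continuous.aestronglyMeasurable ?_) (Eventually.of_forall (hKb i))
    refine Continuous.div continuous_const (by fun_prop) fun t h => ?_
    have := hden i t
    rw [h, norm_zero] at this
    linarith
  -- The nearby zeros are subtracted on the whole line, not only near the real axis: each full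
  -- integral then equals $\hat g(\rho-1)$, and at small heights $R$ coincides with the holomorphic
  -- $E$.
  set R : ℝ → ℂ := fun t => LD t - ∑ i, 1 / (1 + (η + t * I) - ρ i) with hR
  have hsplit : (fun t => Φ t * R t) = fun t =>
      Φ t * LD t - ∑ i, Φ t * (1 / (1 + (η + t * I) - ρ i)) := by
    ext t
    rw [hR, mul_sub, Finset.mul_sum]
  have hΦR : Integrable fun t => Φ t * R t := by
    rw [hsplit]
    exact hΦLD.sub (integrable_finsetSum _ fun i _ => hΦK i)
  have hexplicit : ∑' n : ℕ, χ (n : ZMod D) * (vonMangoldt n : ℂ) / n * g (Real.log n)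
      = -((2 * Real.pi : ℂ)⁻¹ * ∫ t, Φ t * R t) - ∑ i, laplaceTransform g (ρ i - 1) := by
    have h1 : ∀ i, laplaceTransform g (ρ i - 1) = (2 * Real.pi : ℂ)⁻¹ *
        ∫ t : ℝ, Φ t * (1 / (1 + (η + t * I) - ρ i)) := fun i =>
      laplaceTransform_eq_integral_cauchy hg ha hs (by linarith [hρ1 i])
    rw [tsum_twist_vonMangoldt_eq_integral χ hg hcs hη0, hsplit,
      integral_sub hΦLD (integrable_finsetSum _ fun i _ => hΦK i),
      integral_finsetSum _ fun i _ => hΦK i]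
    simp_rw [h1]
    rw [← Finset.mul_sum]
    ring
  set K₃ : ℝ := 3 * (B * b / a ^ 4) with hK₃
  have hK₃0 : 0 ≤ K₃ := by positivity
  have hcube : ∀ z : ℂ, z.re ≤ η → ‖z‖ ^ 3 * ‖laplaceTransform g z‖ ≤ K₃ := fun z hz =>
    norm_laplaceTransform_le_cube hg ha hab hB hs hgB hz
  have hball : ∀ x y : ℝ, x ∈ Icc (-(1 / 16)) η → y ∈ Icc (-(1 / 16 : ℝ)) (1 / 16) →
      ‖(1 + (x + y * I) - 2 : ℂ)‖ ≤ 9 / 8 := by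
    intro x y hx hy
    refine (sq_le_sq₀ (norm_nonneg _) (by norm_num)).1 ?_
    rw [← normSq_eq_norm_sq, normSq_apply]
    simp
    nlinarith [hx.1, hx.2, hy.1, hy.2]
  -- With no poles left, the segment moves to $\Re z=-1/16$, where the support yields $e^{-a/16}$.
  -- On the horizontal sides $|z|\ge1/16$, so the cubic decay applies with $16^3=4096$.
  have hmid : ‖∫ y in (-(1 / 16 : ℝ))..(1 / 16), Φ y * R y‖ ≤
      C₁ * l * (Real.exp (-(a / 16)) * (B * b / a)) + 4096 * K₃ * (C₁ * l) := by
    set F : ℂ → ℂ := fun z => laplaceTransform g z * E (1 + z) with hF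
    have hcongr : ∫ y in (-(1 / 16 : ℝ))..(1 / 16), Φ y * R y
        = ∫ y in (-(1 / 16 : ℝ))..(1 / 16), F (η + y * I) := by
      refine intervalIntegral.integral_congr fun y hy => ?_
      rw [uIcc_of_le (by norm_num)] at hy
      have h1 := hball η y ⟨by linarith, le_rfl⟩ hy
      have h2 := hE (1 + (η + y * I)) (by linarith) (by rw [hre]; linarith)
      simp only [hF, hR, hLD, hΦ, h2]
      ring
    have hΔ := differentiable_laplaceTransform hg.continuous hcs
    have hv := norm_integral_vertical_le (F := F) (η := η) (δ := 1 / 16)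
      (A := Real.exp (-(a / 16)) * (B * b / a) * (C₁ * l)) (H := 4096 * K₃ * (C₁ * l)) hη0
      (by norm_num) ?_ ?_ ?_
    · rw [hcongr]
      refine hv.trans ?_
      have p1 : 0 ≤ Real.exp (-(a / 16)) * (B * b / a) * (C₁ * l) := by positivity
      have p2 : 0 ≤ 4096 * K₃ * (C₁ * l) := by positivity
      nlinarith
    · intro z hz
      rw [mem_reProdIm, uIcc_of_le (by linarith), uIcc_of_le (by norm_num)] at hz
      have h1 := hball z.re z.im hz.1 hz.2
      rw [re_add_im] at h1
      have h2 : DifferentiableAt ℂ E (1 + z) :=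
        hEd.differentiableAt (Metric.isOpen_ball.mem_nhds (by
          rw [Metric.mem_ball, dist_eq_norm]; linarith))
      have h3 : DifferentiableAt ℂ (fun z => E (1 + z)) z :=
        DifferentiableAt.comp z (f := fun z : ℂ => 1 + z) h2 (by fun_prop)
      exact ((hΔ z).mul h3).differentiableWithinAt
    · intro y hy
      have h1 := hball (-(1 / 16)) y ⟨le_rfl, by linarith⟩ hy
      have h2 := hEb _ h1
      have h3 := norm_laplaceTransform_le (g := g)
        (z := (((-(1 / 16) : ℝ) : ℂ) + y * I)) (X := Real.exp (-(a / 16)))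
        (S := B / a) hab hs (fun v hv => (hgB0 v hv).trans (by have := hv.1; gcongr)) (by
          intro v hv
          apply Real.exp_le_exp.2
          simp
          linarith [hv.1])
      have h4 : B / a * (b - a) ≤ B * b / a := by
        rw [div_mul_eq_mul_div]; gcongr; linarith
      have e : (-((1 / 16 : ℝ) : ℂ) + y * I : ℂ) = ((-(1 / 16) : ℝ) : ℂ) + y * I := by push_cast; ring
      rw [e, hF, norm_mul]
      have h5 : ‖laplaceTransform g (((-(1 / 16) : ℝ) : ℂ) + y * I)‖
          ≤ Real.exp (-(a / 16)) * (B * b / a) := h3.trans (by gcongr)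
      exact mul_le_mul h5 h2 (norm_nonneg _) (by positivity)
    · have hH' : ∀ x ∈ Icc (-(1 / 16 : ℝ)) η, ∀ y : ℝ, |y| = 1 / 16 →
          ‖F (x + y * I)‖ ≤ 4096 * K₃ * (C₁ * l) := by
        intro x hx y hy
        have hy' : y ∈ Icc (-(1 / 16 : ℝ)) (1 / 16) := abs_le.1 hy.le
        have h2 := hEb _ (hball x y hx hy')
        have h3 := hcube (x + y * I) (by simpa using hx.2)
        have h4 : (1 / 16 : ℝ) ≤ ‖(x + y * I : ℂ)‖ := by
          rw [← hy]
          simpa using abs_im_le_norm (x + y * I : ℂ)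
        have h5 : (1 / 16 : ℝ) ^ 3 ≤ ‖(x + y * I : ℂ)‖ ^ 3 := by gcongr
        have h6 := norm_nonneg (laplaceTransform g (x + y * I))
        have h7 : ‖laplaceTransform g (x + y * I)‖ ≤ 4096 * K₃ := by nlinarith
        rw [hF, norm_mul]
        exact mul_le_mul h7 h2 (norm_nonneg _) (by positivity)
      intro x hx
      refine ⟨hH' x hx (1 / 16) (by norm_num), ?_⟩
      have := hH' x hx (-(1 / 16)) (by norm_num)
      simpa [sub_eq_add_neg] using this
  have hRb : ∀ t, ‖R t‖ ≤ (C₀ + C₁) * (l * b) := by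
    intro t
    refine (norm_sub_le _ _).trans ?_
    have h1 : ‖∑ i, (1 / (1 + (η + t * I) - ρ i) : ℂ)‖ ≤ N * b := by
      refine (norm_sum_le _ _).trans ((Finset.sum_le_sum fun i _ => hKb i t).trans ?_)
      simp
    have h2 : N * b ≤ C₁ * l * b := by gcongr
    have h3 : C₀ * b ≤ C₀ * (l * b) := by
      gcongr
      nlinarith
    linarith [hLDb t]
  -- The crude $O(lb)$ bound for $R$ is affordable because the transform decays cubically. The
  -- result $lb^2/a^4$ tends to $0$ when $a$, $b$ and $l$ all grow like $\log x$.
  have htail : ∀ t : ℝ, 1 / 16 < |t| →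
      ‖Φ t * R t‖ ≤ 16 * K₃ * ((C₀ + C₁) * (l * b)) / |t| ^ 2 := by
    intro t ht
    have ht0 : 0 < |t| := by linarith
    have h1 := hcube (η + t * I) (by simp)
    have h2 : |t| ≤ ‖(η + t * I : ℂ)‖ := by simpa using abs_im_le_norm (η + t * I : ℂ)
    have h3 : |t| ^ 3 * ‖Φ t‖ ≤ K₃ := le_trans (by gcongr) h1
    have h4 : ‖Φ t‖ * |t| ^ 2 ≤ 16 * K₃ := by
      have : 0 ≤ ‖Φ t‖ * |t| ^ 2 := by positivity
      nlinarith
    rw [norm_mul, le_div_iff₀ (by positivity)]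
    calc ‖Φ t‖ * ‖R t‖ * |t| ^ 2 = (‖Φ t‖ * |t| ^ 2) * ‖R t‖ := by ring
      _ ≤ _ := mul_le_mul h4 (hRb t) (norm_nonneg _) (by positivity)
  have hC01 : 0 < C₀ + C₁ := by linarith
  have hΦRb := norm_integral_le_of_split hΦR (δ := 1 / 16) (by norm_num) (by positivity) hmid htail
  have hzeros : ‖∑ i, laplaceTransform g (ρ i - 1)‖ ≤
      C₁ * l ^ 2 * (Real.exp (-(c / l * a)) * (M / a ^ 2)) := by
    refine (norm_sum_le _ _).trans ((Finset.sum_le_sum fun i _ =>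
      norm_laplaceTransform_zero_le hg ha hM hs hgM (κ := c / l) (by positivity) (hρ i)).trans ?_)
    rw [← Finset.sum_mul]
    gcongr
  have hpi : ‖(2 * Real.pi : ℂ)⁻¹‖ ≤ 1 := by
    rw [norm_inv, norm_mul, Complex.norm_real, Real.norm_of_nonneg Real.pi_pos.le]
    refine inv_le_one_of_one_le₀ ?_
    have := Real.pi_gt_three
    simp
    linarith
  rw [hexplicit]
  refine (norm_sub_le _ _).trans ?_
  rw [norm_neg, norm_mul]
  have h9 : ‖(2 * Real.pi : ℂ)⁻¹‖ * ‖∫ t, Φ t * R t‖ ≤ ‖∫ t, Φ t * R t‖ :=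
    mul_le_of_le_one_left (norm_nonneg _) hpi
  set P : ℝ := l * b ^ 2 / a ^ 4 with hP
  set Q : ℝ := l * Real.exp (-(a / 16)) * b / a with hQ
  set Z : ℝ := M * (l / a) ^ 2 * Real.exp (-(c / l * a)) with hZ
  have hP0 : 0 ≤ P := by positivity
  have hQ0 : 0 ≤ Q := by positivity
  have hZ0 : 0 ≤ Z := by positivity
  have e1 : C₁ * l * (Real.exp (-(a / 16)) * (B * b / a)) = C₁ * (B * Q) := by
    rw [hQ]; field_simp
  have e2 : 4096 * K₃ * (C₁ * l) ≤ 12288 * C₁ * (B * P) := by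
    have : K₃ * l ≤ 3 * (B * P) := by
      have h : B * P = B * b / a ^ 4 * l * b := by rw [hP]; field_simp
      have h0 : 0 ≤ B * b / a ^ 4 * l := by positivity
      calc K₃ * l = 3 * (B * b / a ^ 4 * l) := by rw [hK₃]; ring
        _ ≤ 3 * (B * P) := by
          rw [h]
          exact mul_le_mul_of_nonneg_left (le_mul_of_one_le_right h0 (by linarith)) (by norm_num)
    calc 4096 * K₃ * (C₁ * l) = 4096 * C₁ * (K₃ * l) := by ring
      _ ≤ 4096 * C₁ * (3 * (B * P)) := by gcongr
      _ = _ := by ring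
  have e3 : 16 * K₃ * ((C₀ + C₁) * (l * b)) = 48 * (C₀ + C₁) * (B * P) := by
    rw [hK₃, hP]; field_simp; ring
  have e4 : C₁ * l ^ 2 * (Real.exp (-(c / l * a)) * (M / a ^ 2)) = C₁ * Z := by
    rw [hZ]; field_simp
  rw [e4] at hzeros
  rw [e1, e3] at hΦRb
  have e5 : 48 * (C₀ + C₁) * (B * P) * (1 + 1 / (1 / 16) ^ 2) * Real.pi
      ≤ 49344 * (C₀ + C₁) * (B * P) := by
    have hp : Real.pi ≤ 4 := Real.pi_le_four
    have hq : 0 ≤ (C₀ + C₁) * (B * P) := by positivity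
    calc 48 * (C₀ + C₁) * (B * P) * (1 + 1 / (1 / 16) ^ 2) * Real.pi
        = 12336 * ((C₀ + C₁) * (B * P)) * Real.pi := by ring
      _ ≤ 12336 * ((C₀ + C₁) * (B * P)) * 4 := by gcongr
      _ = _ := by ring
  have hBP : 0 ≤ B * P := by positivity
  have hBQ : 0 ≤ B * Q := by positivity
  have f1 : C₁ * Z ≤ 100000 * (C₀ + C₁) * Z := by gcongr; linarith
  have f2 : C₁ * (B * Q) ≤ 100000 * (C₀ + C₁) * (B * Q) := by gcongr; linarith
  have f3 : 12288 * C₁ * (B * P) + 49344 * (C₀ + C₁) * (B * P)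
      ≤ 100000 * (C₀ + C₁) * (B * P) := by
    rw [← add_mul]; gcongr; linarith
  have f4 : 100000 * (C₀ + C₁) * (Z + B * (P + Q)) = 100000 * (C₀ + C₁) * Z
    + 100000 * (C₀ + C₁) * (B * Q) + 100000 * (C₀ + C₁) * (B * P) := by ring
  rw [f4]
  linarith

end explicitFormulaBound

/-! ### From prime powers to primes. -/

section primes

open Complex Set Filter Topology ArithmeticFunction

theorem contDiff_div_of_support_subset {f : ℝ → ℂ} (hf : ContDiff ℝ ∞ f) {a b : ℝ} (ha : 0 < a)
    (hs : Function.support f ⊆ Icc a b) : ContDiff ℝ ∞ fun v : ℝ => f v * ((v⁻¹ : ℝ) : ℂ) := by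
  rw [contDiff_iff_contDiffAt]
  intro v
  rcases lt_or_ge v a with h | h
  · have h0 : (fun v : ℝ => f v * ((v⁻¹ : ℝ) : ℂ)) =ᶠ[𝓝 v] fun _ => 0 := by
      filter_upwards [Iio_mem_nhds h] with w hw
      have : f w = 0 := by
        by_contra h'
        exact not_le.2 hw (hs h').1
      rw [this, zero_mul]
    exact contDiffAt_const.congr_of_eventuallyEq h0
  · refine hf.contDiffAt.mul (ofRealCLM.contDiff.contDiffAt.comp v ?_)
    exact contDiffAt_inv ℝ (ha.trans_le h).ne'

theorem norm_iteratedDeriv_ofReal_inv (k : ℕ) {v : ℝ} (hv : 0 < v) :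
    ‖iteratedDeriv k (fun v : ℝ => ((v⁻¹ : ℝ) : ℂ)) v‖ = k.factorial / v ^ (k + 1) := by
  have h1 : (fun v : ℝ => ((v⁻¹ : ℝ) : ℂ)) = fun v : ℝ => (v⁻¹ : ℝ) • (1 : ℂ) := by
    ext v; simp
  have h2 : iteratedDeriv k (fun v : ℝ => v⁻¹) v = (-1) ^ k * k.factorial * v ^ (-1 - k : ℤ) := by
    rw [iteratedDeriv_eq_iterate]
    exact iter_deriv_inv k v
  rw [h1, iteratedDeriv_smul_const (contDiffAt_inv ℝ hv.ne'), h2, norm_smul, norm_one, mul_one,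
    norm_mul, norm_mul, norm_pow, norm_neg, norm_one, one_pow, one_mul, norm_zpow,
    Real.norm_of_nonneg hv.le]
  have h3 : v ^ (-1 - k : ℤ) = (v ^ (k + 1))⁻¹ := by
    rw [← zpow_natCast, ← zpow_neg]
    congr 1
    push_cast
    ring
  rw [h3, ← div_eq_mul_inv]
  simp

theorem norm_iteratedDeriv_div_le {f : ℝ → ℂ} (hf : ContDiff ℝ ∞ f) {n : ℕ} (hn : n ≤ 3)
    {v K : ℝ} (hv : 0 < v) (hK : ∀ j ≤ n, v ^ j * ‖iteratedDeriv j f v‖ ≤ K) :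
    ‖iteratedDeriv n (fun v : ℝ => f v * ((v⁻¹ : ℝ) : ℂ)) v‖ ≤ 16 * K / v ^ (n + 1) := by
  have hK0 : 0 ≤ K := le_trans (by positivity) (hK 0 (by omega))
  have hinv : ContDiffAt ℝ n (fun v : ℝ => ((v⁻¹ : ℝ) : ℂ)) v :=
    ofRealCLM.contDiff.contDiffAt.comp v (contDiffAt_inv ℝ hv.ne')
  rw [iteratedDeriv_fun_mul (hf.contDiffAt.of_le (by exact_mod_cast le_top)) hinv]
  have hterm : ∀ i ∈ Finset.range (n + 1), ‖(n.choose i : ℂ) * iteratedDeriv i f v *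
      iteratedDeriv (n - i) (fun v : ℝ => ((v⁻¹ : ℝ) : ℂ)) v‖
      ≤ (n.choose i * (n - i).factorial : ℕ) * (K / v ^ (n + 1)) := by
    intro i hi
    have hi' : i ≤ n := by simpa [Nat.lt_succ_iff] using hi
    rw [norm_mul, norm_mul, norm_iteratedDeriv_ofReal_inv _ hv, norm_natCast]
    have h1 : ‖iteratedDeriv i f v‖ ≤ K / v ^ i := by
      rw [le_div_iff₀ (by positivity), mul_comm]
      exact hK i hi'
    calc (n.choose i : ℝ) * ‖iteratedDeriv i f v‖ * ((n - i).factorial / v ^ (n - i + 1))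
        ≤ n.choose i * (K / v ^ i) * ((n - i).factorial / v ^ (n - i + 1)) := by gcongr
      _ = _ := by
        have : v ^ (n + 1) = v ^ i * v ^ (n - i + 1) := by
          rw [← pow_add]; congr 1; omega
        rw [this]
        push_cast
        field_simp
  refine (norm_sum_le _ _).trans ((Finset.sum_le_sum hterm).trans ?_)
  rw [← Finset.sum_mul, mul_div_assoc]
  refine mul_le_mul_of_nonneg_right ?_ (by positivity)
  -- The Leibniz coefficients are $n!/i!$; the worst case $n=3$ gives $6+6+3+1=16$.
  have : ∑ i ∈ Finset.range (n + 1), n.choose i * (n - i).factorial ≤ 16 := by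
    interval_cases n <;> decide
  exact_mod_cast this

/-- Passing from prime powers, weighted by `Λ`, to primes. -/
theorem exists_norm_tsum_primes_sub_le : ∃ C : ℝ, 0 ≤ C ∧
    ∀ {N : ℕ} (χ : DirichletCharacter ℂ N) {f : ℝ → ℂ} {a b B : ℝ}, 0 < a →
      Function.support f ⊆ Icc a b → (∀ v, ‖f v‖ ≤ B) →
      ‖∑' p : Nat.Primes, χ ((p : ℕ) : ZMod N) / ((p : ℕ) : ℂ) * f (Real.log (p : ℕ)) -
        ∑' n : ℕ, χ (n : ZMod N) * (vonMangoldt n : ℂ) / n *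
          (f (Real.log n) * (((Real.log n)⁻¹ : ℝ) : ℂ))‖ ≤ C * B / a := by
  -- Modulus $1$ makes the residue class all of $\mathbb N$, so $\sum\Lambda(n)/n$ over non-primes
  -- converges.
  have hsum := vonMangoldt.summable_residueClass_non_primes_div (q := 1) 0
  have heq : (fun n : ℕ => (if n.Prime then 0 else vonMangoldt.residueClass (0 : ZMod 1) n) / n)
      = fun n : ℕ => (if n.Prime then 0 else vonMangoldt n) / (n : ℝ) := by
    ext n
    have : vonMangoldt.residueClass (0 : ZMod 1) n = vonMangoldt n := by
      apply indicator_of_mem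
      exact Subsingleton.elim _ _
    rw [this]
  rw [heq] at hsum
  have hnn : ∀ n : ℕ, 0 ≤ (if n.Prime then 0 else vonMangoldt n) / (n : ℝ) := by
    intro n
    split_ifs
    · simp
    · exact div_nonneg vonMangoldt_nonneg (Nat.cast_nonneg n)
  refine ⟨∑' n : ℕ, (if n.Prime then 0 else vonMangoldt n) / (n : ℝ), tsum_nonneg hnn, ?_⟩
  intro N χ f a b B ha hs hB
  have hB0 : 0 ≤ B := (norm_nonneg _).trans (hB 0)
  set F : ℕ → ℂ := fun n => χ (n : ZMod N) * (vonMangoldt n : ℂ) / n *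
    (f (Real.log n) * (((Real.log n)⁻¹ : ℝ) : ℂ)) with hF
  have hFs : Summable F := by
    refine summable_of_hasFiniteSupport ((finite_Iic ⌊Real.exp b⌋₊).subset fun n hn => ?_)
    have h1 : f (Real.log n) ≠ 0 := fun h => hn (by simp [hF, h])
    rcases Nat.eq_zero_or_pos n with rfl | hn0
    · simp
    · have h2 := (hs h1).2
      rw [Real.log_le_iff_le_exp (by exact_mod_cast hn0)] at h2
      exact Nat.le_floor h2
  have hP : ∑' p : Nat.Primes, χ ((p : ℕ) : ZMod N) / ((p : ℕ) : ℂ) * f (Real.log (p : ℕ))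
      = ∑' p : {n : ℕ | n.Prime}, F p := by
    refine tsum_congr fun p : Nat.Primes => ?_
    have h1 : (Real.log (p : ℕ) : ℂ) ≠ 0 := by
      have : 0 < Real.log (p : ℕ) := Real.log_pos (by exact_mod_cast p.2.one_lt)
      exact_mod_cast this.ne'
    have h2 : ((p : ℕ) : ℂ) ≠ 0 := by exact_mod_cast p.2.ne_zero
    simp only [hF]
    rw [vonMangoldt_apply_prime p.2]
    rw [ofReal_inv]
    field_simp
  rw [hP, ← hFs.tsum_subtype_add_tsum_subtype_compl {n : ℕ | n.Prime}, sub_add_cancel_left,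
    norm_neg, tsum_subtype, mul_div_assoc]
  refine tsum_of_norm_bounded (hsum.hasSum.mul_right (B / a)) fun n => ?_
  by_cases hn : n.Prime
  · rw [indicator_of_notMem (by simpa using hn)]
    simp [hn]
  · rw [indicator_of_mem (by simpa using hn)]
    simp only [hn, if_false, hF]
    have h1 : ‖f (Real.log n) * (((Real.log n)⁻¹ : ℝ) : ℂ)‖ ≤ B / a := by
      by_cases h : f (Real.log n) = 0
      · rw [h, zero_mul, norm_zero]; positivity
      · have h2 := (hs h).1
        rw [norm_mul, Complex.norm_real, norm_inv, Real.norm_of_nonneg (ha.le.trans h2),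
          ← div_eq_mul_inv]
        gcongr
        exact hB _
    have h2 : ‖χ (n : ZMod N) * (vonMangoldt n : ℂ) / n‖ ≤ vonMangoldt n / n := by
      rw [norm_div, norm_mul, Complex.norm_natCast, Complex.norm_real,
        Real.norm_of_nonneg vonMangoldt_nonneg]
      gcongr
      exact mul_le_of_le_one_left vonMangoldt_nonneg (χ.norm_le_one _)
    rw [norm_mul]
    exact mul_le_mul h2 h1 (norm_nonneg _) ((norm_nonneg _).trans h2)

/-- Smooth sums of `χ(p) / p` over primes under the zero-free region hypothesis. -/
theorem exists_norm_tsum_primes_le {c : ℝ} (hc : 0 < c) : ∃ C : ℝ, 1 ≤ C ∧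
    ∀ {D : ℕ} [NeZero D], 3 < D → ∀ χ : DirichletCharacter ℂ D, χ ≠ 1 →
      HypothesisH (DirichletCharacter.LFunction χ) D c →
      ∀ {f : ℝ → ℂ} {a b M B : ℝ}, ContDiff ℝ ∞ f → 0 < a → a ≤ b → 16 ≤ b →
        Function.support f ⊆ Icc a b →
        (∀ v ∈ Icc a b, ∀ j ≤ 2, v ^ j * ‖iteratedDeriv j f v‖ ≤ M) →
        (∀ v ∈ Icc a b, ∀ j ≤ 3, v ^ j * ‖iteratedDeriv j f v‖ ≤ B) →
        ‖∑' p : Nat.Primes, χ ((p : ℕ) : ZMod D) / ((p : ℕ) : ℂ) * f (Real.log (p : ℕ))‖ ≤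
          C * (M * (Real.log D / a) ^ 2 * Real.exp (-(c / Real.log D * a)) +
            B * (Real.log D * b ^ 2 / a ^ 4 + Real.log D * Real.exp (-(a / 16)) * b / a +
              1 / a)) := by
  obtain ⟨C₁, hC₁, h₁⟩ := exists_norm_tsum_twist_vonMangoldt_le hc
  obtain ⟨C₂, hC₂, h₂⟩ := exists_norm_tsum_primes_sub_le
  refine ⟨16 * C₁ + C₂, by linarith, ?_⟩
  intro D _ hD χ hχ hH f a b M B hf ha hab hb hs hM hB
  have haI : a ∈ Icc a b := ⟨le_rfl, hab⟩
  have hM0 : 0 ≤ M := le_trans (by positivity) (hM a haI 0 (by norm_num))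
  have hB0 : 0 ≤ B := le_trans (by positivity) (hB a haI 0 (by norm_num))
  have hfB : ∀ v, ‖f v‖ ≤ B := by
    intro v
    by_cases hv : f v = 0
    · simpa [hv] using hB0
    · simpa using hB v (hs hv) 0 (by norm_num)
  -- Dividing the test function by $v=\log n$ cancels $\Lambda(p)=\log p$ at primes. Leibniz
  -- supplies the extra power of $v$ in each derivative bound.
  have e1 := h₁ hD χ hχ hH (g := fun v : ℝ => f v * ((v⁻¹ : ℝ) : ℂ)) (a := a) (b := b)
    (M := 16 * M) (B := 16 * B)
    (contDiff_div_of_support_subset hf ha hs) ha hab hb (by positivity) (by positivity)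
    (fun v hv => hs (fun h => hv (by simp [h])))
    (fun v hv => norm_iteratedDeriv_div_le hf (by norm_num) (ha.trans_le hv.1) (hM v hv))
    (fun v hv => norm_iteratedDeriv_div_le hf (by norm_num) (ha.trans_le hv.1) (hB v hv))
    (fun v hv => by
      have := norm_iteratedDeriv_div_le hf (n := 0) (by norm_num) (ha.trans_le hv.1)
        (fun j hj => hB v hv j (by omega))
      simpa using this)
  have e2 := h₂ χ ha hs hfB
  have e3 := norm_le_norm_add_norm_sub' (∑' p : Nat.Primes, χ ((p : ℕ) : ZMod D) / ((p : ℕ) : ℂ) *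
    f (Real.log (p : ℕ))) (∑' n : ℕ, χ (n : ZMod D) * (vonMangoldt n : ℂ) / n *
          (f (Real.log n) * (((Real.log n)⁻¹ : ℝ) : ℂ)))
  refine e3.trans ((add_le_add e1 e2).trans ?_)
  have hl : 0 ≤ Real.log D := Real.log_nonneg (by exact_mod_cast NeZero.one_le)
  set Z := M * (Real.log D / a) ^ 2 * Real.exp (-(c / Real.log D * a)) with hZ
  set P := Real.log D * b ^ 2 / a ^ 4 + Real.log D * Real.exp (-(a / 16)) * b / a with hP
  have hZ0 : 0 ≤ Z := by positivity
  have hP0 : 0 ≤ P := by have : 0 ≤ b := ha.le.trans hab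
                         positivity
  have e4 : 16 * M * (Real.log D / a) ^ 2 * Real.exp (-(c / Real.log D * a)) = 16 * Z := by
    rw [hZ]; ring
  have e5 : C₂ * B / a = C₂ * (B * (1 / a)) := by ring
  rw [e4, e5]
  have h3 : 0 ≤ B * (1 / a) := by positivity
  have h4 : 0 ≤ B * P := by positivity
  have h5 : 0 ≤ C₁ * (B * (1 / a)) := by positivity
  have h6 : 0 ≤ C₂ * Z := by positivity
  have h7 : 0 ≤ C₂ * (B * P) := by positivity
  have h8 : C₁ * (16 * Z + 16 * B * P) = 16 * C₁ * Z + 16 * C₁ * (B * P) := by ring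
  have h9 : (16 * C₁ + C₂) * (Z + B * (P + 1 / a)) = 16 * C₁ * Z + C₂ * Z + 16 * C₁ * (B * P)
    + C₂ * (B * P) + 16 * (C₁ * (B * (1 / a))) + C₂ * (B * (1 / a)) := by ring
  rw [h8, h9]
  linarith

end primes

/-! ### Passage to the scale $u=\log p/\log x$. -/

section scaling

open Set Filter Topology

theorem chiD_ne_one {D : ℕ} [Fact D.Prime] (hD : 3 < D) : chiD D ≠ 1 := by
  have h2 : ringChar (ZMod D) ≠ 2 := by
    rw [ZMod.ringChar_zmod_n]; omega
  exact (MulChar.ringHomComp_ne_one_iff (Int.cast_injective)).2 (quadraticChar_ne_one h2)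

theorem tendsto_error_atTop (A₁ A₂ A₃ : ℝ) {δ : ℝ} (hδ : 0 < δ) :
    Tendsto (fun L : ℝ => A₁ * L⁻¹ + A₂ * (L ^ (1 : ℝ) * Real.exp (-δ * L)) + A₃ * L⁻¹)
      atTop (𝓝 0) := by
  have h := ((tendsto_inv_atTop_zero.const_mul A₁).add
    ((tendsto_rpow_mul_exp_neg_mul_atTop_nhds_zero 1 δ hδ).const_mul A₂)).add
    (tendsto_inv_atTop_zero.const_mul A₃)
  simpa using h

/-- Smooth prime sums in logarithmic scale, with an error term tending to zero as `x → ∞`. -/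
theorem exists_norm_smoothPrimeCharSum_le {c : ℝ} (hc : 0 < c) : ∃ C : ℝ, 1 ≤ C ∧
    ∀ θ α β ε : ℝ, 0 < θ → 0 < α → α ≤ β → 0 < ε → ∃ x₀ : ℝ, 1 < x₀ ∧ ∀ x, x₀ ≤ x →
      ∀ (D : ℕ) [Fact D.Prime], 3 < D → (D : ℝ) = x ^ θ →
        HypothesisH (DirichletCharacter.LFunction (chiD D)) (D : ℝ) c →
        ∀ {φ : ℝ → ℂ} {M B : ℝ}, ContDiff ℝ ∞ φ → Function.support φ ⊆ Icc α β →
          (∀ u ∈ Icc α β, ∀ j ≤ 2, u ^ j * ‖iteratedDeriv j φ u‖ ≤ M) →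
          (∀ u ∈ Icc α β, ∀ j ≤ 3, u ^ j * ‖iteratedDeriv j φ u‖ ≤ B) →
          ‖smoothPrimeCharSum D φ x‖ ≤
            C * (M * (θ / α) ^ 2 * Real.exp (-(c * α) / θ)) + ε * B := by
  obtain ⟨C, hC, hmain⟩ := exists_norm_tsum_primes_le hc
  refine ⟨C, hC, fun θ α β ε hθ hα hαβ hε => ?_⟩
  have hβ : 0 < β := hα.trans_le hαβ
  have hC0 : 0 < C := by linarith
  -- With $a=\alpha L$, $b=\beta L$ and $\log D=\theta L$, the whole error factor depends on $L$
  -- alone and vanishes at infinity. Thus $x_0$ can be fixed before the test function, uniformly in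
  -- it.
  have h1 : ∀ᶠ L : ℝ in atTop, θ * β ^ 2 / α ^ 4 * L⁻¹ +
      θ * β / α * (L ^ (1 : ℝ) * Real.exp (-(α / 16) * L)) + 1 / α * L⁻¹ < ε / C :=
    (tendsto_error_atTop _ _ _ (by positivity)).eventually_lt_const (by positivity)
  obtain ⟨x₀, hx₀⟩ := eventually_atTop.1 (Real.tendsto_log_atTop.eventually
    (h1.and ((eventually_ge_atTop (16 / β)).and (eventually_gt_atTop 0))))
  refine ⟨max x₀ 2, by simp, ?_⟩
  intro x hx D _ hD hDx hH φ M B hφ hs hM hB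
  obtain ⟨he, hLβ, hL⟩ := hx₀ x ((le_max_left _ _).trans hx)
  have hx0 : 0 < x := by linarith [le_max_right x₀ 2]
  set L := Real.log x with hLdef
  have hlogD : Real.log D = θ * L := by rw [hDx, Real.log_rpow hx0]
  set f : ℝ → ℂ := fun v => φ (L⁻¹ * v) with hf
  have hfd : ContDiff ℝ ∞ f := hφ.comp (contDiff_const.mul contDiff_id)
  have hder : ∀ (j : ℕ) (v : ℝ), 0 ≤ v →
      v ^ j * ‖iteratedDeriv j f v‖ = (L⁻¹ * v) ^ j * ‖iteratedDeriv j φ (L⁻¹ * v)‖ := by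
    intro j v hv
    rw [hf, iteratedDeriv_comp_const_smul (hφ.of_le (by exact_mod_cast le_top)), norm_smul,
      norm_pow, Real.norm_of_nonneg (inv_nonneg.2 hL.le), mul_pow]
    ring
  have hmem : ∀ v, v ∈ Icc (α * L) (β * L) ↔ L⁻¹ * v ∈ Icc α β := by
    intro v
    rw [mem_Icc, mem_Icc, ← div_eq_inv_mul, le_div_iff₀ hL, div_le_iff₀ hL]
  have haL : 0 < α * L := by positivity
  have hfs : Function.support f ⊆ Icc (α * L) (β * L) := fun v hv => (hmem v).2 (hs hv)
  have hb16 : 16 ≤ β * L := by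
    rw [div_le_iff₀ hβ] at hLβ
    linarith
  have key := hmain hD (chiD D) (chiD_ne_one hD) hH (f := f) (a := α * L) (b := β * L) (M := M)
    (B := B) hfd haL (by gcongr) hb16 hfs
    (fun v hv j hj => by
      rw [hder j v (haL.le.trans hv.1)]; exact hM _ ((hmem v).1 hv) j hj)
    (fun v hv j hj => by
      rw [hder j v (haL.le.trans hv.1)]; exact hB _ ((hmem v).1 hv) j hj)
  have hsm : smoothPrimeCharSum D φ x =
      ∑' p : Nat.Primes, chiD D ((p : ℕ) : ZMod D) / ((p : ℕ) : ℂ) * f (Real.log (p : ℕ)) := by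
    rw [smoothPrimeCharSum]
    refine tsum_congr fun p : Nat.Primes => ?_
    simp only [hf]
    rw [← div_eq_inv_mul]
  rw [hsm]
  refine key.trans ?_
  have hB0 : 0 ≤ B := le_trans (by positivity) (hB α ⟨le_rfl, hαβ⟩ 0 (by norm_num))
  rw [hlogD, mul_add]
  have e1 : θ * L / (α * L) = θ / α := by field_simp
  have e2 : -(c / (θ * L) * (α * L)) = -(c * α) / θ := by field_simp
  have e3 : θ * L * (β * L) ^ 2 / (α * L) ^ 4 +
      θ * L * Real.exp (-(α * L / 16)) * (β * L) / (α * L) + 1 / (α * L)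
      = θ * β ^ 2 / α ^ 4 * L⁻¹ +
      θ * β / α * (L ^ (1 : ℝ) * Real.exp (-(α / 16) * L)) + 1 / α * L⁻¹ := by
    rw [Real.rpow_one, show -(α * L / 16) = -(α / 16) * L by ring]
    field_simp
  rw [e1, e2, e3]
  refine add_le_add le_rfl ?_
  calc C * (B * _) ≤ C * (B * (ε / C)) := by gcongr
    _ = ε * B := by field_simp

end scaling

/-! ### Chebyshev bounds for short sums of $1/p$. -/

section chebyshev

/-- The Chebyshev bound for a dyadic block of primes. -/
theorem sum_prime_inv_dyadic_le {y a : ℝ} (ha : 0 < a) (hy : Real.exp a ≤ y) (s : Finset ℕ)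
    (hs : ∀ p ∈ s, p.Prime ∧ y ≤ p ∧ (p : ℝ) < 2 * y) : ∑ p ∈ s, (1 / p : ℝ) ≤ 3 / a := by
  have hy0 : 0 < y := (Real.exp_pos a).trans_le hy
  have hlog : ∀ p ∈ s, (1 / p : ℝ) ≤ Real.log p / (y * a) := by
    intro p hp
    obtain ⟨-, h1, -⟩ := hs p hp
    have h2 : a ≤ Real.log p := (Real.le_log_iff_exp_le (hy0.trans_le h1)).2 (hy.trans h1)
    calc (1 / p : ℝ) ≤ 1 / y := by gcongr
      _ = a / (y * a) := by field_simp
      _ ≤ _ := by gcongr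
  have hθ : ∑ p ∈ s, Real.log p ≤ Chebyshev.theta (2 * y) := by
    rw [Chebyshev.theta]
    refine Finset.sum_le_sum_of_subset_of_nonneg (fun p hp => ?_) fun p _ _ => Real.log_natCast_nonneg p
    obtain ⟨h0, -, h1⟩ := hs p hp
    simp only [Finset.mem_filter, Finset.mem_Ioc]
    exact ⟨⟨h0.pos, Nat.le_floor h1.le⟩, h0⟩
  have hθ' := Chebyshev.theta_le_log4_mul_x (x := 2 * y) (by positivity)
  have hlog4 : Real.log 4 ≤ 3 / 2 := by
    rw [show (4 : ℝ) = 2 ^ 2 by norm_num, Real.log_pow]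
    have := Real.log_two_lt_d9
    push_cast
    linarith
  calc ∑ p ∈ s, (1 / p : ℝ) ≤ ∑ p ∈ s, Real.log p / (y * a) := Finset.sum_le_sum hlog
    _ = (∑ p ∈ s, Real.log p) / (y * a) := by rw [Finset.sum_div]
    _ ≤ (3 / 2 * (2 * y)) / (y * a) := by
      gcongr
      exact (hθ.trans hθ').trans (by gcongr)
    _ = 3 / a := by field_simp

theorem sum_prime_inv_le {a : ℝ} (ha : 0 < a) (k : ℕ) : ∀ s : Finset ℕ,
    (∀ p ∈ s, p.Prime ∧ Real.exp a ≤ p ∧ (p : ℝ) < 2 ^ k * Real.exp a) →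
    ∑ p ∈ s, (1 / p : ℝ) ≤ k * (3 / a) := by
  induction k with
  | zero =>
    intro s hs
    have : s = ∅ := by
      refine Finset.eq_empty_of_forall_notMem fun p hp => ?_
      have := hs p hp
      simp only [pow_zero, one_mul] at this
      linarith [this.2.1, this.2.2]
    simp [this]
  | succ k ih =>
    intro s hs
    rw [← Finset.sum_filter_add_sum_filter_not s (fun p : ℕ => (p : ℝ) < 2 ^ k * Real.exp a)]
    have h1 := ih (s.filter fun p : ℕ => (p : ℝ) < 2 ^ k * Real.exp a) fun p hp => by
      rw [Finset.mem_filter] at hp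
      exact ⟨(hs p hp.1).1, (hs p hp.1).2.1, hp.2⟩
    have h2 := sum_prime_inv_dyadic_le ha (y := 2 ^ k * Real.exp a)
      (le_mul_of_one_le_left (Real.exp_pos a).le (one_le_pow₀ (by norm_num)))
      (s.filter fun p : ℕ => ¬ (p : ℝ) < 2 ^ k * Real.exp a) fun p hp => by
        rw [Finset.mem_filter, not_lt] at hp
        refine ⟨(hs p hp.1).1, hp.2, (hs p hp.1).2.2.trans_eq ?_⟩
        rw [pow_succ]; ring
    push_cast
    linarith

/-- A Mertens type upper bound for `∑ 1 / p` over `a ≤ log p ≤ a'`. -/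
theorem sum_prime_inv_le_of_log_mem {a a' : ℝ} (ha : 0 < a) (haa' : a ≤ a') (s : Finset ℕ)
    (hs : ∀ p ∈ s, p.Prime ∧ a ≤ Real.log p ∧ Real.log p ≤ a') :
    ∑ p ∈ s, (1 / p : ℝ) ≤ 6 * ((a' - a) / a) + 3 / a := by
  -- As $\log2>1/2$, this many dyadic blocks cover $[e^a,e^{a'}]$; the added $1$ makes the upper
  -- inequality strict.
  set k : ℕ := ⌊2 * (a' - a)⌋₊ + 1 with hk
  have hk1 : 2 * (a' - a) < k := by rw [hk]; exact_mod_cast Nat.lt_floor_add_one _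
  have hk2 : (k : ℝ) ≤ 2 * (a' - a) + 1 := by
    rw [hk]; push_cast
    have := Nat.floor_le (show 0 ≤ 2 * (a' - a) by linarith)
    linarith
  have h := sum_prime_inv_le ha k s fun p hp => by
    obtain ⟨h0, h1, h2⟩ := hs p hp
    have hp0 : (0 : ℝ) < p := by exact_mod_cast h0.pos
    refine ⟨h0, (Real.le_log_iff_exp_le hp0).1 h1, ?_⟩
    have h3 : (p : ℝ) ≤ Real.exp (a' - a) * Real.exp a := by
      rw [← Real.exp_add, sub_add_cancel]
      exact (Real.log_le_iff_le_exp hp0).1 h2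
    have h4 : Real.exp (a' - a) < 2 ^ k := by
      rw [← Real.exp_log (show (0 : ℝ) < 2 ^ k by positivity), Real.log_pow]
      apply Real.exp_lt_exp.2
      have := Real.log_two_gt_d9
      nlinarith
    exact h3.trans_lt (by gcongr)
  refine h.trans ?_
  calc (k : ℝ) * (3 / a) ≤ (2 * (a' - a) + 1) * (3 / a) := by gcongr
    _ = _ := by ring

end chebyshev

/-! ### A smooth cutoff with ramps of relative width $1/E$. -/

section cutoff

open Set Filter Topology

/-- The transition is locally constant off $[0,1]$, so its derivatives vanish there and are bounded
by compactness. The vanishing clause is what later confines $u$ to the ramp. -/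
theorem exists_norm_iteratedDeriv_smoothTransition_le : ∃ C : ℝ, 1 ≤ C ∧ ∀ j ≤ 3, ∀ y : ℝ,
    |iteratedDeriv j Real.smoothTransition y| ≤ C ∧
      (j ≠ 0 → y ∉ Icc (0 : ℝ) 1 → iteratedDeriv j Real.smoothTransition y = 0) := by
  have hz : ∀ j : ℕ, j ≠ 0 → ∀ y : ℝ, y ∉ Icc (0 : ℝ) 1 →
      iteratedDeriv j Real.smoothTransition y = 0 := by
    intro j hj y hy
    have hc : ∃ r : ℝ, Real.smoothTransition =ᶠ[𝓝 y] fun _ => r := by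
      rcases lt_or_ge y 0 with h | h
      · refine ⟨0, ?_⟩
        filter_upwards [Iio_mem_nhds h] with w hw
        exact Real.smoothTransition.zero_of_nonpos (le_of_lt hw)
      · have h1 : 1 < y := by
          by_contra h'
          exact hy ⟨h, not_lt.1 h'⟩
        refine ⟨1, ?_⟩
        filter_upwards [Ioi_mem_nhds h1] with w hw
        exact Real.smoothTransition.one_of_one_le (le_of_lt hw)
    obtain ⟨r, hr⟩ := hc
    rw [hr.iteratedDeriv_eq, iteratedDeriv_const, if_neg hj]
  have hb : ∀ j : ℕ, ∃ C : ℝ, 0 ≤ C ∧ ∀ y, |iteratedDeriv j Real.smoothTransition y| ≤ C := by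
    intro j
    rcases eq_or_ne j 0 with rfl | hj
    · refine ⟨1, zero_le_one, fun y => ?_⟩
      rw [iteratedDeriv_zero, abs_of_nonneg (Real.smoothTransition.nonneg y)]
      exact Real.smoothTransition.le_one y
    · have hcont : Continuous (iteratedDeriv j Real.smoothTransition) :=
        (Real.smoothTransition.contDiff (n := (j : ℕ∞))).continuous_iteratedDeriv j le_rfl
      obtain ⟨C, hC⟩ := (isCompact_Icc (a := (0 : ℝ)) (b := 1)).exists_bound_of_continuousOn
        hcont.continuousOn
      refine ⟨|C|, abs_nonneg _, fun y => ?_⟩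
      by_cases hy : y ∈ Icc (0 : ℝ) 1
      · exact (hC y hy).trans (le_abs_self _)
      · rw [hz j hj y hy, abs_zero]; exact abs_nonneg _
  choose C hC0 hC using hb
  refine ⟨1 + ∑ j ∈ Finset.range 4, C j, ?_, fun j hj y => ⟨?_, fun h => hz j h y⟩⟩
  · linarith [Finset.sum_nonneg fun j (_ : j ∈ Finset.range 4) => hC0 j]
  · have := Finset.single_le_sum (fun j (_ : j ∈ Finset.range 4) => hC0 j)
      (Finset.mem_range.2 (by omega : j < 4))
    linarith [hC j y]

/-- A smooth step from `0` at `κ` to `1` at `κ (1 + 1 / E)`. -/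
noncomputable def smoothStep (E κ u : ℝ) : ℝ := Real.smoothTransition (E / κ * u - E)

theorem contDiff_smoothStep (E κ : ℝ) : ContDiff ℝ ∞ (smoothStep E κ) :=
  Real.smoothTransition.contDiff.comp ((contDiff_const.mul contDiff_id).sub contDiff_const)

theorem iteratedDeriv_smoothStep (E κ : ℝ) (j : ℕ) (u : ℝ) :
    iteratedDeriv j (smoothStep E κ) u =
      (E / κ) ^ j * iteratedDeriv j Real.smoothTransition (E / κ * u - E) := by
  have h1 : smoothStep E κ = fun u => (fun w => Real.smoothTransition (w - E)) (E / κ * u) := rfl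
  have h2 : ContDiff ℝ j fun w => Real.smoothTransition (w - E) :=
    (Real.smoothTransition.contDiff (n := (j : ℕ∞))).comp (contDiff_id.sub contDiff_const)
  rw [h1, iteratedDeriv_comp_const_mul h2, iteratedDeriv_comp_sub_const]

/-- A derivative is nonzero only where $(E/\kappa)u\le E+1\le2E$. Hence the scale-invariant weight
$u^j$ yields a bound free of the position $\kappa$. -/
theorem pow_mul_abs_iteratedDeriv_smoothStep_le {C : ℝ} {j : ℕ}
    (hC : ∀ y : ℝ, |iteratedDeriv j Real.smoothTransition y| ≤ C ∧
      (j ≠ 0 → y ∉ Icc (0 : ℝ) 1 → iteratedDeriv j Real.smoothTransition y = 0))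
    {E κ u : ℝ} (hE : 1 ≤ E) (hκ : 0 < κ) (hu : 0 ≤ u) :
    u ^ j * |iteratedDeriv j (smoothStep E κ) u| ≤ (2 * E) ^ j * C := by
  have hC0 : 0 ≤ C := (abs_nonneg _).trans (hC 0).1
  have hE0 : 0 < E := by linarith
  rw [iteratedDeriv_smoothStep, abs_mul, abs_of_nonneg (by positivity), ← mul_assoc, ← mul_pow]
  rcases eq_or_ne j 0 with rfl | hj
  · simpa using (hC (E / κ * u - E)).1
  · by_cases hy : E / κ * u - E ∈ Icc (0 : ℝ) 1
    · have h1 : u * (E / κ) ≤ 2 * E := by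
        rw [mul_comm]; linarith [hy.2]
      exact mul_le_mul (pow_le_pow_left₀ (by positivity) h1 j) (hC _).1 (abs_nonneg _)
        (by positivity)
    · rw [(hC _).2 hj hy, abs_zero, mul_zero]
      positivity

theorem smoothStep_mem (E κ u : ℝ) : smoothStep E κ u ∈ Icc (0 : ℝ) 1 :=
  ⟨Real.smoothTransition.nonneg _, Real.smoothTransition.le_one _⟩

theorem smoothStep_eq_zero {E κ u : ℝ} (hE : 0 < E) (hκ : 0 < κ) (hu : u ≤ κ) :
    smoothStep E κ u = 0 := by
  refine Real.smoothTransition.zero_of_nonpos ?_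
  have : E / κ * u ≤ E / κ * κ := by gcongr
  rw [div_mul_cancel₀ _ hκ.ne'] at this
  linarith

theorem smoothStep_eq_one {E κ u : ℝ} (hE : 0 < E) (hκ : 0 < κ) (hu : κ + κ / E ≤ u) :
    smoothStep E κ u = 1 := by
  refine Real.smoothTransition.one_of_one_le ?_
  have : E / κ * (κ + κ / E) ≤ E / κ * u := by gcongr
  have h2 : E / κ * (κ + κ / E) = E + 1 := by field_simp
  linarith

/-- A smooth approximation to the indicator function of `[α, β)`. -/
noncomputable def smoothIndicator (E α β u : ℝ) : ℂ :=
  ((smoothStep E α u - smoothStep E β u : ℝ) : ℂ)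

theorem contDiff_smoothIndicator (E α β : ℝ) : ContDiff ℝ ∞ (smoothIndicator E α β) :=
  Complex.ofRealCLM.contDiff.comp ((contDiff_smoothStep E α).sub (contDiff_smoothStep E β))

theorem support_smoothIndicator_subset {E α β : ℝ} (hE : 1 ≤ E) (hα : 0 < α) (hαβ : α ≤ β) :
    Function.support (smoothIndicator E α β) ⊆ Icc α (2 * β) := by
  have hE0 : 0 < E := by linarith
  have hβ : 0 < β := hα.trans_le hαβ
  intro u hu
  by_contra h
  refine hu ?_
  rw [smoothIndicator]
  rw [mem_Icc, not_and_or, not_le, not_le] at h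
  rcases h with h | h
  · rw [smoothStep_eq_zero hE0 hα h.le, smoothStep_eq_zero hE0 hβ (h.le.trans hαβ)]
    simp
  · have h1 : ∀ κ, 0 < κ → κ ≤ β → κ + κ / E ≤ u := fun κ h0 hκ => by
      have : κ / E ≤ κ := div_le_self h0.le hE
      linarith
    rw [smoothStep_eq_one hE0 hα (h1 α hα hαβ), smoothStep_eq_one hE0 hβ (h1 β hβ le_rfl)]
    simp

theorem pow_mul_norm_iteratedDeriv_smoothIndicator_le {C : ℝ} {j : ℕ}
    (hC : ∀ y : ℝ, |iteratedDeriv j Real.smoothTransition y| ≤ C ∧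
      (j ≠ 0 → y ∉ Icc (0 : ℝ) 1 → iteratedDeriv j Real.smoothTransition y = 0))
    {E α β u : ℝ} (hE : 1 ≤ E) (hα : 0 < α) (hβ : 0 < β) (hu : 0 ≤ u) :
    u ^ j * ‖iteratedDeriv j (smoothIndicator E α β) u‖ ≤ 2 * ((2 * E) ^ j * C) := by
  have h1 : smoothIndicator E α β
      = fun u => (smoothStep E α - smoothStep E β) u • (1 : ℂ) := by
    ext u; simp [smoothIndicator]
  have hd : ∀ κ, ContDiffAt ℝ j (smoothStep E κ) u := fun κ =>
    (contDiff_smoothStep E κ).contDiffAt.of_le (by exact_mod_cast le_top)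
  have h2 : ContDiffAt ℝ j (smoothStep E α - smoothStep E β) u := (hd α).sub (hd β)
  rw [h1, iteratedDeriv_smul_const h2, norm_smul, norm_one, mul_one,
    iteratedDeriv_sub (hd α) (hd β)]
  have e1 := pow_mul_abs_iteratedDeriv_smoothStep_le hC hE hα hu
  have e2 := pow_mul_abs_iteratedDeriv_smoothStep_le hC hE hβ hu
  calc u ^ j * ‖iteratedDeriv j (smoothStep E α) u - iteratedDeriv j (smoothStep E β) u‖
      ≤ u ^ j * (|iteratedDeriv j (smoothStep E α) u| + |iteratedDeriv j (smoothStep E β) u|) := by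
        gcongr
        exact norm_sub_le _ _
    _ ≤ _ := by rw [mul_add]; linarith

/-- The two functions agree off the ramps at $\alpha$ and $\beta$, and on a ramp each has norm at
most $1$. The case split allows the ramps to overlap. -/
theorem norm_indicator_sub_smoothIndicator_le {E α β : ℝ} (hE : 1 ≤ E) (hα : 0 < α)
    (hαβ : α ≤ β) (u : ℝ) :
    ‖(Ico α β).indicator (fun _ => (1 : ℂ)) u - smoothIndicator E α β u‖ ≤
      2 * (Icc α (α + α / E)).indicator (fun _ => (1 : ℝ)) u +
        2 * (Icc β (β + β / E)).indicator (fun _ => (1 : ℝ)) u := by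
  have hE0 : 0 < E := by linarith
  have hβ : 0 < β := hα.trans_le hαβ
  have hi : ∀ κ, 0 ≤ (Icc κ (κ + κ / E)).indicator (fun _ => (1 : ℝ)) u := fun κ =>
    indicator_nonneg (fun _ _ => zero_le_one) u
  by_cases h : u ∈ Icc α (α + α / E) ∨ u ∈ Icc β (β + β / E)
  · have h1 : ‖(Ico α β).indicator (fun _ => (1 : ℂ)) u‖ ≤ 1 :=
      (norm_indicator_le_norm_self _ _).trans (by simp)
    have h2 : ‖smoothIndicator E α β u‖ ≤ 1 := by
      rw [smoothIndicator, Complex.norm_real, Real.norm_eq_abs, abs_le]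
      have s1 := smoothStep_mem E α u
      have s2 := smoothStep_mem E β u
      constructor <;> linarith [s1.1, s1.2, s2.1, s2.2]
    have h3 := norm_sub_le ((Ico α β).indicator (fun _ => (1 : ℂ)) u) (smoothIndicator E α β u)
    rcases h with h | h
    · rw [indicator_of_mem h]
      linarith [hi β]
    · rw [indicator_of_mem h (f := fun _ => (1 : ℝ))]
      linarith [hi α]
  · rw [not_or, mem_Icc, mem_Icc, not_and_or, not_and_or, not_le, not_le, not_le, not_le] at h
    have h0 : (Ico α β).indicator (fun _ => (1 : ℂ)) u - smoothIndicator E α β u = 0 := by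
      rw [smoothIndicator]
      rcases lt_or_ge u α with h1 | h1
      · rw [indicator_of_notMem (by simp [h1]), smoothStep_eq_zero hE0 hα h1.le,
          smoothStep_eq_zero hE0 hβ (h1.le.trans hαβ)]
        simp
      · have h2 := h.1.resolve_left (not_lt.2 h1)
        rw [smoothStep_eq_one hE0 hα h2.le]
        rcases lt_or_ge u β with h3 | h3
        · rw [indicator_of_mem (mem_Ico.2 ⟨h1, h3⟩), smoothStep_eq_zero hE0 hβ h3.le]
          simp
        · have h4 := h.2.resolve_left (not_lt.2 h3)
          rw [indicator_of_notMem (by simp [h3]), smoothStep_eq_one hE0 hβ h4.le]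
          simp
    rw [h0, norm_zero]
    have := hi α
    have := hi β
    positivity

end cutoff

/-! ### The two estimates. -/

section main

open Set

/-- The sharp and the smoothed prime sums differ by two short sums of `1 / p`. -/
theorem norm_primeCharSum_sub_smoothPrimeCharSum_le {D : ℕ} [Fact D.Prime] {E α β x : ℝ}
    (hE : 1 ≤ E) (hα : 0 < α) (hαβ : α ≤ β) (hx : 1 < x) :
    ‖primeCharSum D (x ^ α) (x ^ β) - smoothPrimeCharSum D (smoothIndicator E α β) x‖ ≤
      24 / E + 12 / (α * Real.log x) := by
  have hE0 : 0 < E := by linarith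
  have hβ : 0 < β := hα.trans_le hαβ
  have hx0 : 0 < x := by linarith
  set L := Real.log x with hL
  have hL0 : 0 < L := Real.log_pos hx
  set N : ℕ := ⌊Real.exp (2 * β * L)⌋₊ + 1 with hN
  set T : Finset ℕ := (Finset.range N).filter Nat.Prime with hT
  have hlt : ∀ (p : ℕ), p.Prime → ∀ γ : ℝ, (p : ℝ) < x ^ γ ↔ Real.log p / L < γ := by
    intro p hp γ
    have hp0 : (0 : ℝ) < p := by exact_mod_cast hp.pos
    rw [div_lt_iff₀ hL0, ← Real.log_rpow hx0, Real.log_lt_log_iff hp0 (Real.rpow_pos_of_pos hx0 _)]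
  have hmemT : ∀ p : ℕ, p.Prime → Real.log p / L ≤ 2 * β → p ∈ T := by
    intro p hp h
    have hp0 : (0 : ℝ) < p := by exact_mod_cast hp.pos
    rw [div_le_iff₀ hL0, Real.log_le_iff_le_exp hp0] at h
    simp only [hT, Finset.mem_filter, Finset.mem_range, hN]
    exact ⟨Nat.lt_succ_of_le (Nat.le_floor h), hp⟩
  have h1 : primeCharSum D (x ^ α) (x ^ β) = ∑ p ∈ T, chiD D (p : ZMod D) / (p : ℂ) *
      (Ico α β).indicator (fun _ => (1 : ℂ)) (Real.log p / L) := by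
    have hind : ∀ p ∈ T, chiD D (p : ZMod D) / (p : ℂ) *
        (Ico α β).indicator (fun _ => (1 : ℂ)) (Real.log p / L) =
        if Real.log p / L ∈ Ico α β then chiD D (p : ZMod D) / (p : ℂ) else 0 := by
      intro p _
      by_cases h : Real.log p / L ∈ Ico α β
      · rw [indicator_of_mem h, if_pos h, mul_one]
      · rw [indicator_of_notMem h, if_neg h, mul_zero]
    rw [Finset.sum_congr rfl hind, ← Finset.sum_filter, primeCharSum]
    refine Finset.sum_congr ?_ fun _ _ => rfl
    ext p
    simp only [Finset.mem_filter, Finset.mem_range, Nat.lt_ceil]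
    constructor
    · rintro ⟨h1, h2, h3⟩
      have h4 := (hlt p h2 β).1 h1
      refine ⟨hmemT p h2 (by linarith), ?_, h4⟩
      by_contra h
      exact absurd ((hlt p h2 α).2 (not_le.1 h)) (not_lt.2 h3)
    · rintro ⟨h1, h2, h3⟩
      have hp : p.Prime := (Finset.mem_filter.1 h1).2
      refine ⟨(hlt p hp β).2 h3, hp, ?_⟩
      by_contra h
      exact absurd ((hlt p hp α).1 (not_le.1 h)) (not_lt.2 h2)
  have h2 : smoothPrimeCharSum D (smoothIndicator E α β) x = ∑ p ∈ T,
      chiD D (p : ZMod D) / (p : ℂ) * smoothIndicator E α β (Real.log p / L) := by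
    set G : ℕ → ℂ := fun p => chiD D (p : ZMod D) / (p : ℂ) *
      smoothIndicator E α β (Real.log p / L) with hG
    have e1 : smoothPrimeCharSum D (smoothIndicator E α β) x
        = ∑' p : {n : ℕ | n.Prime}, G p := rfl
    rw [e1, tsum_subtype, tsum_eq_sum (s := T)]
    · refine Finset.sum_congr rfl fun p hp => ?_
      exact indicator_of_mem (s := {n : ℕ | n.Prime}) (Finset.mem_filter.1 hp).2 G
    · intro p hp
      by_cases hpp : p.Prime
      · rw [indicator_of_mem (by simpa using hpp)]
        have : smoothIndicator E α β (Real.log p / L) = 0 := by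
          by_contra h
          exact hp (hmemT p hpp (support_smoothIndicator_subset hE hα hαβ h).2)
        simp only [hG, this, mul_zero]
      · exact indicator_of_notMem (by simpa using hpp) _
  have hedge : ∀ κ, α ≤ κ → ∑ p ∈ T,
      (1 / p : ℝ) * (Icc κ (κ + κ / E)).indicator (fun _ => (1 : ℝ)) (Real.log p / L)
      ≤ 6 / E + 3 / (α * L) := by
    intro κ hκ
    have hκ0 : 0 < κ := hα.trans_le hκ
    have hind : ∀ p ∈ T,
        (1 / p : ℝ) * (Icc κ (κ + κ / E)).indicator (fun _ => (1 : ℝ)) (Real.log p / L) =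
        if Real.log p / L ∈ Icc κ (κ + κ / E) then (1 / p : ℝ) else 0 := by
      intro p _
      by_cases h : Real.log p / L ∈ Icc κ (κ + κ / E)
      · rw [indicator_of_mem h, if_pos h, mul_one]
      · rw [indicator_of_notMem h, if_neg h, mul_zero]
    rw [Finset.sum_congr rfl hind, ← Finset.sum_filter]
    have hκE : 0 ≤ κ / E := by positivity
    -- The ramp has logarithmic length $1/E$ relative to its left end, so the Mertens-type bound
    -- gives $6/E$ whatever $\kappa$ is.
    refine (sum_prime_inv_le_of_log_mem (a := κ * L) (a' := (κ + κ / E) * L) (by positivity)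
      (by gcongr; linarith) _ fun p hp => ?_).trans ?_
    · rw [Finset.mem_filter, mem_Icc, le_div_iff₀ hL0, div_le_iff₀ hL0] at hp
      exact ⟨(Finset.mem_filter.1 hp.1).2, hp.2⟩
    · have e : 6 * (((κ + κ / E) * L - κ * L) / (κ * L)) = 6 / E := by
        field_simp; ring
      rw [e]
      gcongr
  rw [h1, h2, ← Finset.sum_sub_distrib]
  have hterm : ∀ p ∈ T, ‖chiD D (p : ZMod D) / (p : ℂ) *
      (Ico α β).indicator (fun _ => (1 : ℂ)) (Real.log p / L) -
      chiD D (p : ZMod D) / (p : ℂ) * smoothIndicator E α β (Real.log p / L)‖ ≤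
      2 * ((1 / p : ℝ) * (Icc α (α + α / E)).indicator (fun _ => (1 : ℝ)) (Real.log p / L)) +
      2 * ((1 / p : ℝ) * (Icc β (β + β / E)).indicator (fun _ => (1 : ℝ)) (Real.log p / L)) := by
    intro p _
    rw [← mul_sub, norm_mul, norm_div, Complex.norm_natCast]
    have e1 : ‖chiD D (p : ZMod D)‖ / (p : ℝ) ≤ 1 / p := by
      gcongr; exact (chiD D).norm_le_one _
    have e2 := norm_indicator_sub_smoothIndicator_le hE hα hαβ (Real.log p / L)
    refine (mul_le_mul e1 e2 (norm_nonneg _) (by positivity)).trans (le_of_eq ?_)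
    ring
  refine (norm_sum_le _ _).trans ((Finset.sum_le_sum hterm).trans ?_)
  rw [Finset.sum_add_distrib, ← Finset.mul_sum, ← Finset.mul_sum]
  have a1 := hedge α le_rfl
  have a2 := hedge β hαβ
  have e : 24 / E + 12 / (α * L) = 4 * (6 / E + 3 / (α * L)) := by ring
  rw [e]
  linarith

/-- The smoothing is balanced: two derivatives cost $E^2$ against the saving
$E^{-3}=e^{-c\alpha_1/\theta}$, matching the ramp loss $O(1/E)$. The cost $E^3$ of a third
derivative meets only the error that vanishes with $x$. -/
theorem exists_norm_primeCharSum_le {c K : ℝ} (hc : 0 < c) : ∃ C : ℝ, 0 ≤ C ∧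
    ∀ θ α₁ α₂ : ℝ, 0 < θ → 0 < α₁ → α₁ < α₂ → θ ≤ K * α₁ →
      ∃ x₀ : ℝ, ∀ x : ℝ, x₀ ≤ x →
        ∀ (D : ℕ) [Fact D.Prime], 3 < D → (D : ℝ) = x ^ θ →
          HypothesisH (DirichletCharacter.LFunction (chiD D)) (D : ℝ) c →
            ‖primeCharSum D (x ^ α₁) (x ^ α₂)‖ ≤ C * Real.exp (-(c * α₁) / (3 * θ)) := by
  obtain ⟨C, hC, hmain⟩ := exists_norm_smoothPrimeCharSum_le hc
  obtain ⟨S, hS, hST⟩ := exists_norm_iteratedDeriv_smoothTransition_le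
  -- The $8S$ comes from $2(2E)^2S$; the $26$ is $24$ from the ramps plus one each from the
  -- Chebyshev error and the vanishing error.
  refine ⟨C * (8 * S) * K ^ 2 + 26, by positivity, fun θ α₁ α₂ hθ hα₁ hα hK => ?_⟩
  have hα₂ : 0 < α₂ := hα₁.trans hα
  set E : ℝ := Real.exp (c * α₁ / (3 * θ)) with hE
  have hE1 : 1 ≤ E := Real.one_le_exp (by positivity)
  have hE0 : 0 < E := by linarith
  have hEinv : Real.exp (-(c * α₁) / (3 * θ)) = 1 / E := by
    rw [hE, neg_div, Real.exp_neg, one_div]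
  have hE3 : Real.exp (-(c * α₁) / θ) = 1 / E ^ 3 := by
    rw [hE, ← Real.exp_nat_mul, one_div, ← Real.exp_neg]
    congr 1
    push_cast
    field_simp
  have hbd : ∀ m ≤ 3, ∀ u ∈ Icc α₁ (2 * α₂), ∀ j ≤ m,
      u ^ j * ‖iteratedDeriv j (smoothIndicator E α₁ α₂) u‖ ≤ 2 * ((2 * E) ^ m * S) := by
    intro m hm u hu j hj
    refine (pow_mul_norm_iteratedDeriv_smoothIndicator_le (hST j (hj.trans hm)) hE1 hα₁ hα₂
      (hα₁.le.trans hu.1)).trans ?_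
    have : (2 * E) ^ j ≤ (2 * E) ^ m := pow_le_pow_right₀ (by linarith) hj
    gcongr
  set B : ℝ := 2 * ((2 * E) ^ 3 * S) with hB
  have hB0 : 0 < B := by positivity
  -- This tolerance reduces the term with the third derivative to exactly $1/E$.
  obtain ⟨x₀, hx₀, hsm⟩ := hmain θ α₁ (2 * α₂) (1 / (E * B)) hθ hα₁ (by linarith) (by positivity)
  refine ⟨max x₀ (Real.exp (12 * E / α₁)), fun x hx D _ hD hDx hH => ?_⟩
  rw [max_le_iff] at hx
  have hx1 : 1 < x := hx₀.trans_le hx.1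
  have hlog : 12 * E / α₁ ≤ Real.log x := (Real.le_log_iff_exp_le (by linarith)).2 hx.2
  have k1 := hsm x hx.1 D hD hDx hH (contDiff_smoothIndicator E α₁ α₂)
    (support_smoothIndicator_subset hE1 hα₁ hα.le) (hbd 2 (by norm_num)) (hbd 3 le_rfl)
  have k2 := norm_primeCharSum_sub_smoothPrimeCharSum_le (D := D) hE1 hα₁ hα.le hx1
  have k3 := norm_le_norm_add_norm_sub' (primeCharSum D (x ^ α₁) (x ^ α₂))
    (smoothPrimeCharSum D (smoothIndicator E α₁ α₂) x)
  have k4 : 12 / (α₁ * Real.log x) ≤ 1 / E := by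
    rw [div_le_iff₀ hα₁] at hlog
    have hLpos := Real.log_pos hx1
    rw [div_le_div_iff₀ (by positivity) hE0]
    linarith
  have k5 : (θ / α₁) ^ 2 ≤ K ^ 2 := by
    have : θ / α₁ ≤ K := by rwa [div_le_iff₀ hα₁]
    gcongr
  have k6 : C * (2 * ((2 * E) ^ 2 * S) * (θ / α₁) ^ 2 * Real.exp (-(c * α₁) / θ))
      ≤ C * (8 * S) * K ^ 2 * (1 / E) := by
    rw [hE3]
    calc C * (2 * ((2 * E) ^ 2 * S) * (θ / α₁) ^ 2 * (1 / E ^ 3))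
        = C * (8 * S) * (θ / α₁) ^ 2 * (1 / E) := by field_simp; ring
      _ ≤ _ := by gcongr
  have k7 : 1 / (E * B) * B = 1 / E := by field_simp
  rw [hEinv]
  have k8 : 24 / E = 24 * (1 / E) := by ring
  rw [k7] at k1
  rw [k8] at k2
  linarith

/-- On the support $u<1$, so the weights $u^j$ may be dropped, and $\alpha_2-\alpha_1\le1$ makes the
highest derivative dominate. Only two derivatives reach the zeros, hence the exponent $-2$. -/
theorem exists_norm_smoothPrimeCharSum_le_of_iteratedDeriv_le {c K : ℝ} (hc : 0 < c) :
    ∃ C : ℝ, 0 ≤ C ∧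
      ∀ θ α₁ α₂ : ℝ, 0 < θ → 0 < α₁ → α₁ < α₂ → α₂ < 1 → θ ≤ K * α₁ →
        ∃ x₀ : ℝ, ∀ x : ℝ, x₀ ≤ x →
          ∀ (D : ℕ) [Fact D.Prime], 3 < D → (D : ℝ) = x ^ θ →
            HypothesisH (DirichletCharacter.LFunction (chiD D)) (D : ℝ) c →
              ∀ (φ : ℝ → ℂ) (A : ℝ), ContDiff ℝ ∞ φ →
                Function.support φ ⊆ Icc α₁ α₂ →
                (∀ j : ℕ, j ≤ 3 → ∀ u : ℝ,
                  (α₂ - α₁) ^ j * ‖iteratedDeriv j φ u‖ ≤ A) →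
                ‖smoothPrimeCharSum D φ x‖ ≤
                  C * A * ((α₂ - α₁) ^ 2)⁻¹ * Real.exp (-(c * α₁) / θ) := by
  obtain ⟨C, hC, hmain⟩ := exists_norm_smoothPrimeCharSum_le hc
  refine ⟨C * K ^ 2 + 1, by positivity, fun θ α₁ α₂ hθ hα₁ hα hα₂ hK => ?_⟩
  set h : ℝ := α₂ - α₁ with hh
  have hh0 : 0 < h := by linarith
  have hh1 : h ≤ 1 := by linarith
  set e : ℝ := Real.exp (-(c * α₁) / θ) with he
  have he0 : 0 < e := Real.exp_pos _
  -- The factor $h$ in the tolerance turns the loss $h^{-3}$ of the third derivative into $h^{-2}$,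
  -- and $e$ supplies the target decay.
  obtain ⟨x₀, -, hsm⟩ := hmain θ α₁ α₂ (h * e) hθ hα₁ hα.le (by positivity)
  refine ⟨x₀, fun x hx D _ hD hDx hH φ A hφ hs hA => ?_⟩
  have hA0 : 0 ≤ A := le_trans (by positivity) (hA 0 (by norm_num) 0)
  have hbd : ∀ m ≤ 3, ∀ u ∈ Icc α₁ α₂, ∀ j ≤ m,
      u ^ j * ‖iteratedDeriv j φ u‖ ≤ A * (h ^ m)⁻¹ := by
    intro m hm u hu j hj
    have h1 : u ^ j ≤ 1 := pow_le_one₀ (hα₁.le.trans hu.1) (hu.2.trans hα₂.le)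
    have h2 := hA j (hj.trans hm) u
    have h3 : h ^ m ≤ h ^ j := pow_le_pow_of_le_one hh0.le hh1 hj
    rw [← div_eq_mul_inv, le_div_iff₀ (by positivity)]
    calc u ^ j * ‖iteratedDeriv j φ u‖ * h ^ m ≤ 1 * ‖iteratedDeriv j φ u‖ * h ^ j := by gcongr
      _ = h ^ j * ‖iteratedDeriv j φ u‖ := by ring
      _ ≤ A := h2
  have k1 := hsm x hx D hD hDx hH hφ hs (hbd 2 (by norm_num)) (hbd 3 le_rfl)
  have k5 : (θ / α₁) ^ 2 ≤ K ^ 2 := by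
    have : θ / α₁ ≤ K := by rwa [div_le_iff₀ hα₁]
    gcongr
  refine k1.trans ?_
  calc C * (A * (h ^ 2)⁻¹ * (θ / α₁) ^ 2 * e) + h * e * (A * (h ^ 3)⁻¹)
      = C * (A * (h ^ 2)⁻¹ * (θ / α₁) ^ 2 * e) + A * (h ^ 2)⁻¹ * e := by field_simp
    _ ≤ C * (A * (h ^ 2)⁻¹ * K ^ 2 * e) + A * (h ^ 2)⁻¹ * e := by gcongr
    _ = _ := by ring

end main

theorem mainTheorem7 :
    ∀ c : ℝ, 0 < c → ∀ K : ℝ, 0 < K →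
      ∃ C : ℝ, 0 < C ∧
        ∀ θ α₁ α₂ : ℝ, 0 < θ → θ < 1 → 0 < α₁ → α₁ < α₂ → α₂ < 1 → θ ≤ K * α₁ →
          ∃ x₀ : ℝ, ∀ x : ℝ, x₀ ≤ x →
            ∀ (D : ℕ) [Fact D.Prime], 3 < D → D % 4 = 3 → (D : ℝ) = x ^ θ →
              HypothesisH (DirichletCharacter.LFunction (chiD D)) (D : ℝ) c →
                ‖primeCharSum D (x ^ α₁) (x ^ α₂)‖ ≤ C * Real.exp (-(c * α₁) / (3 * θ)) ∧
                ∀ (φ : ℝ → ℂ) (A : ℝ), ContDiff ℝ ∞ φ →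
                  Function.support φ ⊆ Set.Icc α₁ α₂ →
                  (∀ j : ℕ, j ≤ 3 → ∀ u : ℝ,
                    (α₂ - α₁) ^ j * ‖iteratedDeriv j φ u‖ ≤ A) →
                  ‖smoothPrimeCharSum D φ x‖ ≤
                    C * A * ((α₂ - α₁) ^ 2)⁻¹ * Real.exp (-(c * α₁) / θ) := by
  intro c hc K _
  obtain ⟨C₁, hC₁, h₁⟩ := exists_norm_primeCharSum_le (K := K) hc
  obtain ⟨C₂, hC₂, h₂⟩ := exists_norm_smoothPrimeCharSum_le_of_iteratedDeriv_le (K := K) hc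
  refine ⟨C₁ + C₂ + 1, by linarith, fun θ α₁ α₂ hθ _ hα₁ hα hα₂ hK => ?_⟩
  obtain ⟨x₁, hx₁⟩ := h₁ θ α₁ α₂ hθ hα₁ hα hK
  obtain ⟨x₂, hx₂⟩ := h₂ θ α₁ α₂ hθ hα₁ hα hα₂ hK
  refine ⟨max x₁ x₂, fun x hx D _ hD _ hDx hH => ⟨?_, fun φ A hφ hs hA => ?_⟩⟩
  · refine (hx₁ x ((le_max_left _ _).trans hx) D hD hDx hH).trans ?_
    gcongr
    linarith
  · refine (hx₂ x ((le_max_right _ _).trans hx) D hD hDx hH φ A hφ hs hA).trans ?_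
    have hA0 : 0 ≤ A := le_trans (by positivity) (hA 0 (by norm_num) 0)
    gcongr
    linarith
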